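/- Let $n\ge 2$ and $m\ge 1$. Let $V=\{a\in\mathbb R^n:\sum_i a_i=0\}$ with the standard inner product, let $\varepsilon_1,\dots,\varepsilon_n$ be the standard basis of $\mathbb R^n$, let $\Delta^+=\{\varepsilon_i-\varepsilon_j: i<j\}$ be the positive roots, $\alpha_i=\varepsilon_i-\varepsilon_{i+1}$ $(1\le i<n)$ the simple roots, $\theta=\varepsilon_1-\varepsilon_n$ the highest root, and $H_{\alpha,k}=\{v\in V:\langle v,\alpha\rangle=k\}$. Regions of the $m$-Shi arrangement are the connected components of the complement in $V$ of all $H_{\alpha,k}$ with $\alpha\in\Delta^+$, $-m<k\le m$; alcoves are the connected components of the complement of all $H_{\alpha,k}$ with $\alpha\in\Delta^+$, $k\in\mathbb Z$. The fundamental alcove $\mathcal A_0$ is the interior of $\{v:\langle v,\theta\rangle\le 1,\ \langle v,\alpha_i\rangle\ge 0 \text{ for all } i\}$. A region is dominant if it is contained in $\{v:\langle v,\alpha_i\rangle\ge0\text{ for all }i\}$. The $m$-minimal alcove of a region is the alcove contained in it that is closest to $\mathcal A_0$, i.e. separated from $\mathcal A_0$ by the fewest hyperplanes $H_{\alpha,k}$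 $(\alpha\in\Delta^+,\ k\in\mathbb Z)$. A separating wall of a region $R$ is a hyperplane of the $m$-Shi arrangement that supports a facet of $R$ and separates $R$ from $\mathcal A_0$. Let $\widehat{\mathfrak S}_n=\langle s_0,\dots,s_{n-1}\rangle$ be the affine symmetric group (the Coxeter group of type $\widetilde A_{n-1}$) and $\mathfrak S_n=\langle s_1,\dots,s_{n-1}\rangle$. It acts on $V$: $s_i$ $(i\neq0)$ is the reflection in $H_{\alpha_i,0}$ and $s_0$ the reflection in $H_{\theta,1}$. It acts on $n$-cores (partitions none of whose hook lengths is divisible by $n$): the box in row $i$ and column $j$ has residue $j-i \bmod n$, and $s_r$ adds all addable boxes of residue $r$ if there are any, removes all removable boxes of residue $r$ if there are any, and otherwise fixes the core. Let $\Phi$ be the bijection from $n$-cores to dominant alcoves given by $\Phi(w\emptyset)=w^{-1}\mathcal A_0$ for $w\in\widehat{\mathfrak S}_n$ of minimal length in its coset $w\mathfrak S_n$. Let $R$ be a dominant region of the $m$-Shi arrangement with $m$-minimal alcove $\mathcal A$, and let $\lambda$ be the $n$-core with $\Phi(\lambda)=\mathcal A$. Then $H_{\theta,m}$ is a separating wall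 of $R$ if and only if $h_{11}^{\lambda}=n(m-1)+1$, where $h_{11}^\lambda$ is the hook length of the box in the first row and first column of $\lambda$ (for $\lambda=\emptyset$ the equality is regarded as false). -/

import Mathlib

namespace ShiCore

noncomputable section

/-! ### The space `V`, roots and hyperplanes

Coordinates are indexed by `Fin n`, i.e. by `0, …, n - 1`; arithmetic on `Fin n` is modulo `n`, so
`-1 : Fin n` is the last index. -/

/-- `V = {(a₁, …, aₙ) ∈ ℝⁿ : a₁ + ⋯ + aₙ = 0}`, with the inner product of Euclidean space. -/
def V (n : ℕ) : Submodule ℝ (EuclideanSpace ℝ (Fin n)) where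
  carrier := {v | ∑ i, v i = 0}
  zero_mem' := by simp
  add_mem' := by
    intro a b ha hb
    simp only [Set.mem_ofPred_eq, PiLp.add_apply, Finset.sum_add_distrib] at *
    rw [ha, hb, add_zero]
  smul_mem' := by
    intro c a ha
    simp only [Set.mem_ofPred_eq, PiLp.smul_apply, smul_eq_mul, ← Finset.mul_sum] at *
    rw [ha, mul_zero]

/-- The vector `eᵢ - eⱼ` of `V`. -/
def root {n : ℕ} (i j : Fin n) : V n :=
  ⟨EuclideanSpace.single i (1 : ℝ) - EuclideanSpace.single j (1 : ℝ), by
    change ∑ k, (EuclideanSpace.single i (1 : ℝ) - EuclideanSpace.single j (1 : ℝ) :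
      EuclideanSpace ℝ (Fin n)) k = 0
    simp⟩

/-- The positive roots `eᵢ - eⱼ`, `i < j`. -/
def posRoots (n : ℕ) : Set (V n) := {α | ∃ i j : Fin n, i < j ∧ α = root i j}

/-- For `i ≠ 0` the simple root `αᵢ`; for `i = 0` the vector `-θ`. -/
def simpleRoot {n : ℕ} [NeZero n] (i : Fin n) : V n := root (i - 1) i

/-- The highest root `θ = e₁ - eₙ`. -/
def theta (n : ℕ) [NeZero n] : V n := root 0 (-1)

/-- The hyperplane `{v ∈ V : ⟨v, α⟩ = k}`. -/
def hyperplane {n : ℕ} (α : V n) (k : ℤ) : Set (V n) := {v | inner ℝ v α = (k : ℝ)}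

/-- The closed half-space `{v ∈ V : ⟨v, α⟩ ≥ k}`. -/
def halfPos {n : ℕ} (α : V n) (k : ℤ) : Set (V n) := {v | (k : ℝ) ≤ inner ℝ v α}

/-- The closed half-space `{v ∈ V : ⟨v, α⟩ ≤ k}`. -/
def halfNeg {n : ℕ} (α : V n) (k : ℤ) : Set (V n) := {v | inner ℝ v α ≤ (k : ℝ)}

/-! ### Arrangements, regions, alcoves, walls -/

/-- The `m`-Shi arrangement: all hyperplanes `⟨v, α⟩ = k` with `α > 0` and `-m < k ≤ m`. -/
def shiArrangement (n m : ℕ) : Set (Set (V n)) :=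
  {H | ∃ α ∈ posRoots n, ∃ k : ℤ, -(m : ℤ) < k ∧ k ≤ (m : ℤ) ∧ H = hyperplane α k}

/-- The affine arrangement: all hyperplanes `⟨v, α⟩ = k` with `α > 0` and `k ∈ ℤ`. -/
def affineArrangement (n : ℕ) : Set (Set (V n)) :=
  {H | ∃ α ∈ posRoots n, ∃ k : ℤ, H = hyperplane α k}

/-- `R` is a connected component of the complement of the arrangement `𝓗`. -/
def IsRegion {n : ℕ} (𝓗 : Set (Set (V n))) (R : Set (V n)) : Prop :=
  ∃ x ∈ (⋃₀ 𝓗)ᶜ, R = connectedComponentIn (⋃₀ 𝓗)ᶜ x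

/-- The (closed) dominant chamber `⋂ᵢ {v : ⟨v, αᵢ⟩ ≥ 0}`. -/
def dominantChamber (n : ℕ) [NeZero n] : Set (V n) :=
  ⋂ i : {i : Fin n // i ≠ 0}, halfPos (simpleRoot i.1) 0

/-- Dominant regions of the `m`-Shi arrangement. -/
def IsDominantRegion (n m : ℕ) [NeZero n] (R : Set (V n)) : Prop :=
  IsRegion (shiArrangement n m) R ∧ R ⊆ dominantChamber n

/-- Alcoves. -/
def IsAlcove (n : ℕ) (A : Set (V n)) : Prop := IsRegion (affineArrangement n) A

/-- The fundamental alcove `A₀`. -/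
def fundamentalAlcove (n : ℕ) [NeZero n] : Set (V n) :=
  interior (halfNeg (theta n) 1 ∩ dominantChamber n)

/-- The hyperplane `⟨v, α⟩ = k` separates `A` and `B`: they lie in different closed half-spaces. -/
def Separates {n : ℕ} (α : V n) (k : ℤ) (A B : Set (V n)) : Prop :=
  (A ⊆ halfPos α k ∧ B ⊆ halfNeg α k) ∨ (A ⊆ halfNeg α k ∧ B ⊆ halfPos α k)

/-- The distance between alcoves: the number of hyperplanes of the affine arrangement separating
them (distinct pairs `(α, k)` with `α > 0` give distinct hyperplanes). -/
def alcoveDist {n : ℕ} (A B : Set (V n)) : ℕ∞ :=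
  Set.encard {p : V n × ℤ | p.1 ∈ posRoots n ∧ Separates p.1 p.2 A B}

/-- `A` is an `m`-minimal alcove of the region `R`: among the alcoves contained in `R` it is
closest to `A₀`. -/
def IsMinimalAlcove (n : ℕ) [NeZero n] (R A : Set (V n)) : Prop :=
  IsAlcove n A ∧ A ⊆ R ∧ ∀ B, IsAlcove n B → B ⊆ R →
    alcoveDist A (fundamentalAlcove n) ≤ alcoveDist B (fundamentalAlcove n)

/-- `H` is a wall of the region `R` of `𝓗`: it belongs to `𝓗` and supports a facet of `R`, i.e.
`closure R ∩ H` affinely spans `H`. -/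
def IsWall {n : ℕ} (𝓗 : Set (Set (V n))) (H R : Set (V n)) : Prop :=
  H ∈ 𝓗 ∧ (affineSpan ℝ (closure R ∩ H) : Set (V n)) = H

/-- The hyperplane `⟨v, α⟩ = k` is a separating wall of the region `R` of the `m`-Shi arrangement:
a wall of `R` that separates `R` from `A₀`. -/
def IsSeparatingWall (n m : ℕ) [NeZero n] (α : V n) (k : ℤ) (R : Set (V n)) : Prop :=
  IsWall (shiArrangement n m) (hyperplane α k) R ∧ Separates α k R (fundamentalAlcove n)

/-! ### The affine symmetric group and its action on `V` -/

/-- The Coxeter matrix of the affine symmetric group on generators `s₀, …, sₙ₋₁` (an entry `0`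
means that there is no relation). -/
def affineMatrix (n : ℕ) [NeZero n] : CoxeterMatrix (Fin n) where
  M := Matrix.of fun i j =>
    if i = j then 1 else if n = 2 then 0 else if i = j + 1 ∨ j = i + 1 then 3 else 2
  isSymm := by
    ext i j
    simp only [Matrix.transpose_apply, Matrix.of_apply, eq_comm (a := i) (b := j),
      or_comm (a := i = j + 1)]
  diagonal := by simp
  off_diagonal := by
    intro i j hij
    simp only [Matrix.of_apply, if_neg hij]
    split_ifs <;> norm_num

/-- The affine symmetric group, given by its Coxeter presentation. -/
abbrev AffSym (n : ℕ) [NeZero n] : Type := (affineMatrix n).Group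

/-- The affine symmetric group with its generators `s₀, …, sₙ₋₁`. -/
abbrev affSystem (n : ℕ) [NeZero n] : CoxeterSystem (affineMatrix n) (AffSym n) :=
  (affineMatrix n).toCoxeterSystem

/-- `0` for `i ≠ 0`, and `-1` for `i = 0`: then `⟨v, simpleRoot i⟩ = reflLevel i` is the hyperplane
`H_{αᵢ,0}` for `i ≠ 0`, and `H_{-θ,-1} = H_{θ,1}` for `i = 0`. -/
def reflLevel {n : ℕ} [NeZero n] (i : Fin n) : ℝ := if i = 0 then -1 else 0

/-- The map of `V` by which `sᵢ` acts: the reflection in `H_{αᵢ,0}` for `i ≠ 0`, and the reflection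
in `H_{θ,1}` for `i = 0`. -/
def reflFun {n : ℕ} [NeZero n] (i : Fin n) (v : V n) : V n :=
  v - (inner ℝ v (simpleRoot i) - reflLevel i) • simpleRoot i

theorem inner_root {n : ℕ} (v : V n) (i j : Fin n) :
    inner ℝ v (root i j) = (v : EuclideanSpace ℝ (Fin n)) i - (v : EuclideanSpace ℝ (Fin n)) j := by
  rw [Submodule.coe_inner]
  simp [root, inner_sub_right, EuclideanSpace.inner_single_right]

theorem root_apply {n : ℕ} (i j k : Fin n) :
    (root i j : EuclideanSpace ℝ (Fin n)) k
      = (if k = i then 1 else 0) - (if k = j then 1 else 0) := by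
  simp [root]

theorem inner_smul_V {n : ℕ} (c : ℝ) (v w : V n) : inner ℝ (c • v) w = c * inner ℝ v w :=
  real_inner_smul_left v w c

theorem sub_one_ne {n : ℕ} [NeZero n] (hn : n ≠ 1) (i : Fin n) : i - 1 ≠ i := by
  intro h
  have h1 : (1 : Fin n) = 0 := sub_eq_self.mp h
  exact hn (Fin.one_eq_zero_iff.mp h1)

theorem inner_simpleRoot_self {n : ℕ} [NeZero n] (hn : n ≠ 1) (i : Fin n) :
    inner ℝ (simpleRoot i) (simpleRoot i) = (2 : ℝ) := by
  have h := sub_one_ne hn i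
  simp only [simpleRoot, inner_root, root_apply, if_true, if_neg h, if_neg h.symm]
  norm_num

theorem simpleRoot_eq_zero (i : Fin 1) : simpleRoot i = 0 := by
  simp [simpleRoot, root]

theorem reflFun_invol {n : ℕ} [NeZero n] (i : Fin n) (v : V n) : reflFun i (reflFun i v) = v := by
  by_cases hn : n = 1
  · subst hn
    simp [reflFun, simpleRoot_eq_zero]
  · have h := inner_simpleRoot_self hn i
    simp only [reflFun, inner_sub_left, inner_smul_V, h]
    module

/-- The reflection by which `sᵢ` acts, as a permutation of `V`. -/
def refl {n : ℕ} [NeZero n] (i : Fin n) : Equiv.Perm (V n) where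
  toFun := reflFun i
  invFun := reflFun i
  left_inv := reflFun_invol i
  right_inv := reflFun_invol i

theorem reflFun_comm {n : ℕ} [NeZero n] {i j : Fin n}
    (h : inner ℝ (simpleRoot i) (simpleRoot j) = (0 : ℝ)) (v : V n) :
    reflFun i (reflFun j v) = reflFun j (reflFun i v) := by
  have h' : inner ℝ (simpleRoot j) (simpleRoot i) = (0 : ℝ) := by rw [real_inner_comm]; exact h
  simp only [reflFun, inner_sub_left, inner_smul_V, h, h']
  module

theorem reflFun_braid {n : ℕ} [NeZero n] (hn : n ≠ 1) {i j : Fin n}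
    (h : inner ℝ (simpleRoot i) (simpleRoot j) = (-1 : ℝ)) (v : V n) :
    reflFun i (reflFun j (reflFun i v)) = reflFun j (reflFun i (reflFun j v)) := by
  have h' : inner ℝ (simpleRoot j) (simpleRoot i) = (-1 : ℝ) := by rw [real_inner_comm]; exact h
  simp only [reflFun, inner_sub_left, inner_smul_V, h, h', inner_simpleRoot_self hn]
  module

theorem inner_simpleRoot_add_one {n : ℕ} [NeZero n] (hn : n ≠ 1) (hn2 : n ≠ 2) (j : Fin n) :
    inner ℝ (simpleRoot (j + 1)) (simpleRoot j) = (-1 : ℝ) := by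
  have h := sub_one_ne hn j
  have h1 : j + 1 ≠ j := by
    have := sub_one_ne hn (j + 1)
    rw [add_sub_cancel_right] at this
    exact this.symm
  have h2 : j - 1 ≠ j + 1 := by
    intro e
    have e2 : (1 : Fin n) + 1 = 0 := by
      have e3 : j = j + (1 + 1) := by
        rw [← add_assoc, ← e, sub_add_cancel]
      exact left_eq_add.mp e3
    have h3 : 3 ≤ n := by
      have := NeZero.ne n
      omega
    have e4 := congrArg Fin.val e2
    rw [Fin.val_add, Fin.val_one', Fin.val_zero, Nat.mod_eq_of_lt (by omega : 1 < n),
      Nat.mod_eq_of_lt (by omega : 1 + 1 < n)] at e4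
    omega
  simp only [simpleRoot, inner_root, root_apply, add_sub_cancel_right, if_true, if_neg h,
    if_neg h1.symm, if_neg h2]
  norm_num

theorem refl_isLiftable (n : ℕ) [NeZero n] :
    (affineMatrix n).IsLiftable (refl : Fin n → Equiv.Perm (V n)) := by
  have hmul (i : Fin n) : (refl i : Equiv.Perm (V n)) * refl i = 1 :=
    Equiv.ext fun v => reflFun_invol i v
  intro i j
  change (refl i * refl j) ^ (if i = j then 1 else if n = 2 then 0
    else if i = j + 1 ∨ j = i + 1 then 3 else 2) = 1
  split_ifs with hij hn hadj
  · rw [hij, pow_one, hmul]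
  · exact pow_zero _
  · have hn1 : n ≠ 1 := by
      rintro rfl
      exact hij (Subsingleton.elim _ _)
    have h : inner ℝ (simpleRoot i) (simpleRoot j) = (-1 : ℝ) := by
      rcases hadj with rfl | rfl
      · exact inner_simpleRoot_add_one hn1 hn j
      · rw [real_inner_comm]
        exact inner_simpleRoot_add_one hn1 hn i
    ext1 v
    change reflFun i (reflFun j (reflFun i (reflFun j (reflFun i (reflFun j v))))) = v
    rw [reflFun_braid hn1 h (reflFun j (reflFun i (reflFun j v))), reflFun_invol, reflFun_invol,
      reflFun_invol]
  · have h : inner ℝ (simpleRoot i) (simpleRoot j) = (0 : ℝ) := by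
      have h1 : i - 1 ≠ j := fun e => hadj (Or.inl (sub_eq_iff_eq_add.mp e))
      have h2 : j - 1 ≠ i := fun e => hadj (Or.inr (sub_eq_iff_eq_add.mp e))
      have h3 : j - 1 ≠ i - 1 := fun e => hij (sub_left_injective e).symm
      simp only [simpleRoot, inner_root, root_apply, if_neg h1.symm, if_neg h2, if_neg h3,
        if_neg (Ne.symm hij)]
      norm_num
    ext1 v
    change reflFun i (reflFun j (reflFun i (reflFun j v))) = v
    rw [reflFun_comm h (reflFun i (reflFun j v)), reflFun_invol, reflFun_invol]

/-- The action of the affine symmetric group on `V`. -/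
def geomAction (n : ℕ) [NeZero n] : AffSym n →* Equiv.Perm (V n) :=
  (affSystem n).lift ⟨refl, refl_isLiftable n⟩

/-- The subgroup `𝔖ₙ` generated by `s₁, …, sₙ₋₁`. -/
def finiteSubgroup (n : ℕ) [NeZero n] : Subgroup (AffSym n) :=
  Subgroup.closure {g | ∃ i : Fin n, i ≠ 0 ∧ g = (affSystem n).simple i}

/-- `w` has minimal length in its coset `w𝔖ₙ`. -/
def IsMinCosetRep (n : ℕ) [NeZero n] (w : AffSym n) : Prop :=
  ∀ u ∈ finiteSubgroup n, (affSystem n).length w ≤ (affSystem n).length (w * u)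

/-! ### Partitions, cores and the action on cores

The box in row `i` and column `j` (counted from `1`) is the cell `(i - 1, j - 1)`. -/

/-- The hook length of the box `c` of `μ`: the number of boxes of `μ` that are `c`, to the right of
`c` in its row, or below `c` in its column. -/
def hookLength (μ : YoungDiagram) (c : ℕ × ℕ) : ℕ :=
  (μ.cells.filter fun d => (d.1 = c.1 ∧ c.2 ≤ d.2) ∨ (d.2 = c.2 ∧ c.1 ≤ d.1)).card

/-- `μ` is an `n`-core. -/
def IsCore (n : ℕ) (μ : YoungDiagram) : Prop := ∀ c ∈ μ, ¬ n ∣ hookLength μ c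

/-- The cell `c` has residue `r` modulo `n`. -/
def HasResidue (n : ℕ) (r : Fin n) (c : ℕ × ℕ) : Prop :=
  (c.2 : ℤ) - (c.1 : ℤ) ≡ ((r : ℕ) : ℤ) [ZMOD (n : ℤ)]

/-- The cell `c` is not in `μ`, and adding it gives a partition. -/
def IsAddable (μ : YoungDiagram) (c : ℕ × ℕ) : Prop :=
  c ∉ μ ∧ IsLowerSet ((insert c μ.cells : Finset (ℕ × ℕ)) : Set (ℕ × ℕ))

/-- The cell `c` is in `μ`, and removing it gives a partition. -/
def IsRemovable (μ : YoungDiagram) (c : ℕ × ℕ) : Prop :=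
  c ∈ μ ∧ IsLowerSet ((μ.cells.erase c : Finset (ℕ × ℕ)) : Set (ℕ × ℕ))

open Classical in
/-- The set of all addable cells of residue `r`, see `mem_addableCells`. -/
def addableCells (n : ℕ) (r : Fin n) (μ : YoungDiagram) : Finset (ℕ × ℕ) :=
  (Finset.range (μ.colLen 0 + 1) ×ˢ Finset.range (μ.rowLen 0 + 1)).filter
    fun c => IsAddable μ c ∧ HasResidue n r c

theorem mem_addableCells {n : ℕ} {r : Fin n} {μ : YoungDiagram} {c : ℕ × ℕ} :
    c ∈ addableCells n r μ ↔ IsAddable μ c ∧ HasResidue n r c := by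
  simp only [addableCells, Finset.mem_filter, Finset.mem_product, Finset.mem_range,
    and_iff_right_iff_imp]
  rintro ⟨⟨hc, hl⟩, -⟩
  obtain ⟨i, j⟩ := c
  constructor
  · by_contra! h
    have hlt : μ.colLen 0 < i := by simp only at h; omega
    have h1 : (μ.colLen 0, 0) ∈ μ := by
      have h2 := hl (show (μ.colLen 0, 0) ≤ (i, j) from ⟨hlt.le, Nat.zero_le _⟩)
        (by simp)
      simp only [Finset.coe_insert, Set.mem_insert_iff, Prod.mk.injEq] at h2
      rcases h2 with h2 | h2
      · omega
      · exact h2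
    exact lt_irrefl _ (YoungDiagram.mem_iff_lt_colLen.mp h1)
  · by_contra! h
    have hlt : μ.rowLen 0 < j := by simp only at h; omega
    have h1 : (0, μ.rowLen 0) ∈ μ := by
      have h2 := hl (show (0, μ.rowLen 0) ≤ (i, j) from ⟨Nat.zero_le _, hlt.le⟩)
        (by simp)
      simp only [Finset.coe_insert, Set.mem_insert_iff, Prod.mk.injEq] at h2
      rcases h2 with h2 | h2
      · omega
      · exact h2
    exact lt_irrefl _ (YoungDiagram.mem_iff_lt_rowLen.mp h1)

open Classical in
/-- The set of all removable cells of residue `r`. -/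
def removableCells (n : ℕ) (r : Fin n) (μ : YoungDiagram) : Finset (ℕ × ℕ) :=
  μ.cells.filter fun c => IsRemovable μ c ∧ HasResidue n r c

theorem mem_removableCells {n : ℕ} {r : Fin n} {μ : YoungDiagram} {c : ℕ × ℕ} :
    c ∈ removableCells n r μ ↔ IsRemovable μ c ∧ HasResidue n r c := by
  simp only [removableCells, Finset.mem_filter, YoungDiagram.mem_cells, and_iff_right_iff_imp]
  exact fun h => h.1.1

/-- Add all addable cells of residue `r`. -/
def addAll (n : ℕ) (r : Fin n) (μ : YoungDiagram) : YoungDiagram where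
  cells := μ.cells ∪ addableCells n r μ
  isLowerSet := by
    intro a b hba ha
    rw [Finset.mem_coe, Finset.mem_union] at ha ⊢
    rcases ha with ha | ha
    · exact Or.inl (μ.isLowerSet hba ha)
    · have h := (mem_addableCells.mp ha).1.2 hba (by simp)
      rw [Finset.mem_coe, Finset.mem_insert] at h
      rcases h with rfl | h
      · exact Or.inr ha
      · exact Or.inl h

/-- Remove all removable cells of residue `r`. -/
def removeAll (n : ℕ) (r : Fin n) (μ : YoungDiagram) : YoungDiagram where
  cells := μ.cells \ removableCells n r μ
  isLowerSet := by
    intro a b hba ha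
    rw [Finset.mem_coe, Finset.mem_sdiff] at ha ⊢
    refine ⟨μ.isLowerSet hba ha.1, fun hb => ?_⟩
    have hab : a ≠ b := by
      rintro rfl
      exact ha.2 hb
    have h := (mem_removableCells.mp hb).1.2 hba
      (Finset.mem_coe.mpr (Finset.mem_erase.mpr ⟨hab, ha.1⟩))
    simp at h

open Classical in
/-- The action of the generator `s_r` on (core) partitions. -/
def coreStep (n : ℕ) (r : Fin n) (μ : YoungDiagram) : YoungDiagram :=
  if (addableCells n r μ).Nonempty then addAll n r μ
  else if (removableCells n r μ).Nonempty then removeAll n r μ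
  else μ

/-- `μ = w∅`: for some expression `w = s_{i₁} ⋯ s_{iₖ}` one has `μ = s_{i₁}(⋯ s_{iₖ}(∅) ⋯)`. -/
def IsOrbitOfEmpty (n : ℕ) [NeZero n] (w : AffSym n) (μ : YoungDiagram) : Prop :=
  ∃ ω : List (Fin n), (affSystem n).wordProd ω = w ∧ μ = ω.foldr (coreStep n) ⊥

/-! ### The map `Φ` -/

/-- `Φ(μ) = A`, where `Φ` is the map `w∅ ↦ w⁻¹A₀`, for `w` of minimal length in `w𝔖ₙ`. -/
def PhiMapsTo (n : ℕ) [NeZero n] (μ : YoungDiagram) (A : Set (V n)) : Prop :=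
  ∃ w : AffSym n, IsMinCosetRep n w ∧ IsOrbitOfEmpty n w μ ∧
    A = geomAction n w⁻¹ '' fundamentalAlcove n

end

end ShiCore

namespace ShiCore

noncomputable section

/-! ### Affine permutations -/

/-- The involution of `ℤ` exchanging `z` and `z + 1` for all `z ≡ r - 1` modulo `n`. -/
def swapFun (n : ℕ) (r : Fin n) (z : ℤ) : ℤ :=
  if (n : ℤ) ∣ z + 1 - (r : ℕ) then z + 1 else if (n : ℤ) ∣ z - (r : ℕ) then z - 1 else z

theorem not_dvd_one {n : ℕ} (hn : 2 ≤ n) : ¬ (n : ℤ) ∣ 1 := by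
  intro h
  have := Int.le_of_dvd one_pos h
  omega

theorem swapFun_of_dvd_succ {n : ℕ} {r : Fin n} {z : ℤ} (h : (n : ℤ) ∣ z + 1 - (r : ℕ)) :
    swapFun n r z = z + 1 := if_pos h

theorem swapFun_of_dvd {n : ℕ} (hn : 2 ≤ n) {r : Fin n} {z : ℤ} (h : (n : ℤ) ∣ z - (r : ℕ)) :
    swapFun n r z = z - 1 := by
  rw [swapFun, if_neg, if_pos h]
  intro h'
  apply not_dvd_one hn
  have := dvd_sub h' h
  rwa [show z + 1 - (r : ℕ) - (z - (r : ℕ)) = (1 : ℤ) by ring] at this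

theorem swapFun_of_not_dvd {n : ℕ} {r : Fin n} {z : ℤ} (h : ¬ (n : ℤ) ∣ z + 1 - (r : ℕ))
    (h' : ¬ (n : ℤ) ∣ z - (r : ℕ)) : swapFun n r z = z := by
  rw [swapFun, if_neg h, if_neg h']

theorem swapFun_invol {n : ℕ} (hn : 2 ≤ n) (r : Fin n) :
    Function.Involutive (swapFun n r) := by
  intro z
  by_cases h : (n : ℤ) ∣ z + 1 - (r : ℕ)
  · rw [swapFun_of_dvd_succ h, swapFun_of_dvd hn h, add_sub_cancel_right]
  by_cases h' : (n : ℤ) ∣ z - (r : ℕ)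
  · rw [swapFun_of_dvd hn h', swapFun_of_dvd_succ (by rwa [sub_add_cancel]), sub_add_cancel]
  · rw [swapFun_of_not_dvd h h', swapFun_of_not_dvd h h']

theorem swapFun_add {n : ℕ} (r : Fin n) (z : ℤ) : swapFun n r (z + n) = swapFun n r z + n := by
  have e1 : z + n + 1 - (r : ℕ) = z + 1 - (r : ℕ) + n := by ring
  have e2 : z + n - (r : ℕ) = z - (r : ℕ) + (n : ℤ) := by ring
  simp only [swapFun, e1, e2, dvd_add_self_right]
  split_ifs <;> ring

/-- The affine permutation by which a word in the generators acts on `ℤ`. -/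
def affPerm {n : ℕ} (hn : 2 ≤ n) (ω : List (Fin n)) : Equiv.Perm ℤ :=
  (ω.map fun r => (swapFun_invol hn r).toPerm).prod

theorem affPerm_nil {n : ℕ} (hn : 2 ≤ n) (z : ℤ) : affPerm hn [] z = z := rfl

theorem affPerm_cons {n : ℕ} (hn : 2 ≤ n) (r : Fin n) (ω : List (Fin n)) (z : ℤ) :
    affPerm hn (r :: ω) z = swapFun n r (affPerm hn ω z) := by
  simp [affPerm]

theorem affPerm_add {n : ℕ} (hn : 2 ≤ n) (ω : List (Fin n)) (z : ℤ) :
    affPerm hn ω (z + n) = affPerm hn ω z + n := by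
  induction ω with
  | nil => simp [affPerm_nil]
  | cons r ω ih => rw [affPerm_cons, affPerm_cons, ih, swapFun_add]

theorem add_mul_of_add {n : ℕ} {φ : ℤ → ℤ} (h : ∀ z, φ (z + n) = φ z + n) (z l : ℤ) :
    φ (z + n * l) = φ z + n * l := by
  induction l using Int.induction_on with
  | zero => simp
  | succ k ih => rw [mul_add, ← add_assoc, mul_one, h, ih]; ring
  | pred k ih =>
    have := h (z + n * (-(k : ℤ) - 1))
    rw [show z + n * (-(k : ℤ) - 1) + n = z + n * -(k : ℤ) by ring, ih] at this
    linarith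

/-! ### Beads -/

/-- The bead set (Maya diagram) of a partition. -/
def beads (μ : YoungDiagram) : Set ℤ := {z | ∃ i : ℕ, z = μ.rowLen i - i - 1}

theorem rowLen_bot (i : ℕ) : (⊥ : YoungDiagram).rowLen i = 0 := by
  by_contra h
  exact YoungDiagram.notMem_bot (i, 0) (YoungDiagram.mem_iff_lt_rowLen.mpr (Nat.pos_of_ne_zero h))

theorem mem_beads_bot (z : ℤ) : z ∈ beads ⊥ ↔ z < 0 := by
  simp only [beads, rowLen_bot, Set.mem_ofPred_eq]
  constructor
  · rintro ⟨i, rfl⟩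
    push_cast
    omega
  · intro h
    exact ⟨(-z - 1).toNat, by push_cast; omega⟩

theorem isAddable_iff {μ : YoungDiagram} {i j : ℕ} :
    IsAddable μ (i, j) ↔ j = μ.rowLen i ∧ ∀ i' < i, μ.rowLen i < μ.rowLen i' := by
  simp only [IsAddable, YoungDiagram.mem_iff_lt_rowLen]
  constructor
  · rintro ⟨h, hl⟩
    have hj : j = μ.rowLen i := by
      by_contra hne
      have h1 := hl (show (i, μ.rowLen i) ≤ (i, j) from ⟨le_rfl, not_lt.mp h⟩) (by simp)
      simp only [Finset.coe_insert, Set.mem_insert_iff, Prod.mk.injEq, Finset.mem_coe,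
        YoungDiagram.mem_cells, YoungDiagram.mem_iff_lt_rowLen, lt_irrefl, or_false] at h1
      exact hne h1.2.symm
    refine ⟨hj, fun i' hi' => ?_⟩
    have h1 := hl (show (i', j) ≤ (i, j) from ⟨hi'.le, le_rfl⟩) (by simp)
    simp only [Finset.coe_insert, Set.mem_insert_iff, Prod.mk.injEq, Finset.mem_coe,
        YoungDiagram.mem_cells, YoungDiagram.mem_iff_lt_rowLen] at h1
    omega
  · rintro ⟨rfl, h⟩
    refine ⟨lt_irrefl _, ?_⟩
    rintro ⟨a1, a2⟩ ⟨b1, b2⟩ ⟨h1, h2⟩ ha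
    simp only [Finset.coe_insert, Set.mem_insert_iff, Prod.mk.injEq, Finset.mem_coe,
        YoungDiagram.mem_cells, YoungDiagram.mem_iff_lt_rowLen] at ha h1 h2 ⊢
    have := μ.rowLen_anti b1 a1 h1
    rcases ha with ⟨rfl, rfl⟩ | ha
    · rcases h1.lt_or_eq with h3 | rfl
      · have := h b1 h3
        omega
      · omega
    · omega

theorem isRemovable_iff {μ : YoungDiagram} {i j : ℕ} :
    IsRemovable μ (i, j) ↔ j + 1 = μ.rowLen i ∧ ∀ i', i < i' → μ.rowLen i' < μ.rowLen i := by
  simp only [IsRemovable, YoungDiagram.mem_iff_lt_rowLen]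
  constructor
  · rintro ⟨h, hl⟩
    have key : ∀ a b, i ≤ a → j ≤ b → b < μ.rowLen a → a = i ∧ b = j := by
      intro a b h1 h2 h3
      by_contra hne
      have h4 := hl (show (i, j) ≤ (a, b) from ⟨h1, h2⟩) (by
        simpa [YoungDiagram.mem_iff_lt_rowLen, h3] using hne)
      simp at h4
    have hj : j + 1 = μ.rowLen i := by
      by_contra hne
      have := key i (j + 1) le_rfl (by omega) (by omega)
      omega
    refine ⟨hj, fun i' hi' => ?_⟩
    by_contra hlt
    have := key i' j hi'.le le_rfl (by omega)
    omega
  · rintro ⟨hj, h⟩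
    refine ⟨by omega, ?_⟩
    rintro ⟨a1, a2⟩ ⟨b1, b2⟩ ⟨h1, h2⟩ ha
    simp only [Finset.coe_erase, Set.mem_sdiff, Set.mem_singleton_iff, Prod.mk.injEq,
      Finset.mem_coe, YoungDiagram.mem_cells, YoungDiagram.mem_iff_lt_rowLen] at ha h1 h2 ⊢
    have := μ.rowLen_anti b1 a1 h1
    refine ⟨by omega, ?_⟩
    rintro ⟨rfl, rfl⟩
    rcases h1.lt_or_eq with h3 | rfl
    · have := h a1 h3
      omega
    · omega

theorem add_one_notMem_beads_iff {μ : YoungDiagram} {i : ℕ} :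
    (μ.rowLen i - i - 1 + 1 : ℤ) ∉ beads μ ↔ ∀ i' < i, μ.rowLen i < μ.rowLen i' := by
  constructor
  · intro h i' hi'
    by_contra hlt
    apply h
    have h1 := μ.rowLen_anti i' (i - 1) (by omega)
    have h2 := μ.rowLen_anti (i - 1) i (by omega)
    exact ⟨i - 1, by omega⟩
  · rintro h ⟨i', h'⟩
    rcases lt_or_ge i' i with h1 | h1
    · have := h i' h1
      omega
    · have := μ.rowLen_anti i i' h1
      omega

theorem sub_one_notMem_beads_iff {μ : YoungDiagram} {i : ℕ} :
    (μ.rowLen i - i - 1 - 1 : ℤ) ∉ beads μ ↔ ∀ i', i < i' → μ.rowLen i' < μ.rowLen i := by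
  constructor
  · intro h i' hi'
    by_contra hlt
    apply h
    have h1 := μ.rowLen_anti (i + 1) i' (by omega)
    have h2 := μ.rowLen_anti i (i + 1) (by omega)
    exact ⟨i + 1, by omega⟩
  · rintro h ⟨i', h'⟩
    rcases lt_or_ge i i' with h1 | h1
    · have := h i' h1
      omega
    · have := μ.rowLen_anti i' i h1
      omega

theorem hasResidue_iff {n : ℕ} {r : Fin n} {i j : ℕ} :
    HasResidue n r (i, j) ↔ (n : ℤ) ∣ (j : ℤ) - i - (r : ℕ) := by
  rw [HasResidue, Int.modEq_comm, Int.modEq_iff_dvd]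

theorem mem_addableCells_iff {n : ℕ} {r : Fin n} {μ : YoungDiagram} {i j : ℕ} :
    (i, j) ∈ addableCells n r μ ↔ j = μ.rowLen i ∧ (μ.rowLen i - i - 1 + 1 : ℤ) ∉ beads μ ∧
      (n : ℤ) ∣ (μ.rowLen i - i - 1 : ℤ) + 1 - (r : ℕ) := by
  rw [mem_addableCells, isAddable_iff, add_one_notMem_beads_iff, hasResidue_iff, and_assoc]
  refine and_congr_right ?_
  rintro rfl
  rw [sub_add_cancel]

theorem mem_removableCells_iff {n : ℕ} {r : Fin n} {μ : YoungDiagram} {i j : ℕ} :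
    (i, j) ∈ removableCells n r μ ↔ j + 1 = μ.rowLen i ∧
      (μ.rowLen i - i - 1 - 1 : ℤ) ∉ beads μ ∧ (n : ℤ) ∣ (μ.rowLen i - i - 1 : ℤ) - (r : ℕ) := by
  rw [mem_removableCells, isRemovable_iff, sub_one_notMem_beads_iff, hasResidue_iff, and_assoc]
  refine and_congr_right fun h => ?_
  rw [← h]
  push_cast
  rw [show (j : ℤ) + 1 - i - 1 - (r : ℕ) = j - i - (r : ℕ) by ring]

open Classical in
theorem rowLen_addAll {n : ℕ} {r : Fin n} {μ : YoungDiagram} (i : ℕ) :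
    (addAll n r μ).rowLen i = μ.rowLen i +
      if (μ.rowLen i - i - 1 + 1 : ℤ) ∉ beads μ ∧
        (n : ℤ) ∣ (μ.rowLen i - i - 1 : ℤ) + 1 - (r : ℕ) then 1 else 0 := by
  apply eq_of_forall_lt_iff
  intro j
  rw [← YoungDiagram.mem_iff_lt_rowLen, ← YoungDiagram.mem_cells]
  change (i, j) ∈ μ.cells ∪ addableCells n r μ ↔ _
  rw [Finset.mem_union, YoungDiagram.mem_cells, YoungDiagram.mem_iff_lt_rowLen,
    mem_addableCells_iff]
  split_ifs with h
  · simp only [h, not_false_eq_true, and_true]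
    omega
  · simp only [h, and_false, or_false, add_zero]

open Classical in
theorem rowLen_removeAll {n : ℕ} {r : Fin n} {μ : YoungDiagram} (i : ℕ) :
    ((removeAll n r μ).rowLen i : ℤ) = μ.rowLen i -
      if (μ.rowLen i - i - 1 - 1 : ℤ) ∉ beads μ ∧
        (n : ℤ) ∣ (μ.rowLen i - i - 1 : ℤ) - (r : ℕ) then 1 else 0 := by
  have key : ∀ j, j < (removeAll n r μ).rowLen i ↔ j < μ.rowLen i ∧
      ¬ (j + 1 = μ.rowLen i ∧ (μ.rowLen i - i - 1 - 1 : ℤ) ∉ beads μ ∧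
        (n : ℤ) ∣ (μ.rowLen i - i - 1 : ℤ) - (r : ℕ)) := by
    intro j
    rw [← YoungDiagram.mem_iff_lt_rowLen, ← YoungDiagram.mem_cells]
    change (i, j) ∈ μ.cells \ removableCells n r μ ↔ _
    rw [Finset.mem_sdiff, YoungDiagram.mem_cells, YoungDiagram.mem_iff_lt_rowLen,
      mem_removableCells_iff]
  split_ifs with h
  · have hpos : μ.rowLen i ≠ 0 := by
      intro h0
      apply h.1
      have := μ.rowLen_anti i (i + 1) (by omega)
      exact ⟨i + 1, by omega⟩
    have : (removeAll n r μ).rowLen i = μ.rowLen i - 1 := by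
      apply eq_of_forall_lt_iff
      intro j
      rw [key]
      simp only [h, not_false_eq_true, and_true]
      omega
    omega
  · have : (removeAll n r μ).rowLen i = μ.rowLen i := by
      apply eq_of_forall_lt_iff
      intro j
      rw [key]
      simp only [h, and_false, not_false_eq_true, and_true]
    omega

theorem mem_beads_addAll {n : ℕ} (hn : 2 ≤ n) {r : Fin n} {μ : YoungDiagram}
    (h : ∀ z ∈ beads μ, (n : ℤ) ∣ z - (r : ℕ) → z - 1 ∈ beads μ) (z : ℤ) :
    z ∈ beads (addAll n r μ) ↔ swapFun n r z ∈ beads μ := by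
  have hone := not_dvd_one hn
  constructor
  · rintro ⟨i, rfl⟩
    rw [rowLen_addAll]
    split_ifs with hi
    · push_cast
      rw [show (μ.rowLen i + 1 - i - 1 : ℤ) = (μ.rowLen i - i - 1 : ℤ) + 1 by ring,
        swapFun_of_dvd hn hi.2, add_sub_cancel_right]
      exact ⟨i, rfl⟩
    · rw [add_zero]
      have hmem : (μ.rowLen i - i - 1 : ℤ) ∈ beads μ := ⟨i, rfl⟩
      by_cases h1 : (n : ℤ) ∣ (μ.rowLen i - i - 1 : ℤ) + 1 - (r : ℕ)
      · rw [swapFun_of_dvd_succ h1]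
        by_contra h2
        exact hi ⟨h2, h1⟩
      by_cases h2 : (n : ℤ) ∣ (μ.rowLen i - i - 1 : ℤ) - (r : ℕ)
      · rw [swapFun_of_dvd hn h2]
        exact h _ hmem h2
      · rwa [swapFun_of_not_dvd h1 h2]
  · have keep : ∀ y ∈ beads μ, (y + 1 ∈ beads μ ∨ ¬ (n : ℤ) ∣ y + 1 - (r : ℕ)) →
        y ∈ beads (addAll n r μ) := by
      rintro _ ⟨i, rfl⟩ hy
      refine ⟨i, ?_⟩
      rw [rowLen_addAll, if_neg (by tauto), add_zero]
    intro hz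
    by_cases h1 : (n : ℤ) ∣ z + 1 - (r : ℕ)
    · rw [swapFun_of_dvd_succ h1] at hz
      have h2 := h _ hz h1
      rw [add_sub_cancel_right] at h2
      exact keep z h2 (Or.inl hz)
    by_cases h2 : (n : ℤ) ∣ z - (r : ℕ)
    · rw [swapFun_of_dvd hn h2] at hz
      by_cases h3 : z ∈ beads μ
      · exact keep z h3 (Or.inr h1)
      · obtain ⟨i, hi⟩ := hz
        refine ⟨i, ?_⟩
        rw [rowLen_addAll, ← hi, sub_add_cancel, if_pos ⟨h3, h2⟩]
        push_cast
        linarith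
    · rw [swapFun_of_not_dvd h1 h2] at hz
      exact keep z hz (Or.inr h1)

theorem mem_beads_removeAll {n : ℕ} (hn : 2 ≤ n) {r : Fin n} {μ : YoungDiagram}
    (h : ∀ z ∈ beads μ, (n : ℤ) ∣ z + 1 - (r : ℕ) → z + 1 ∈ beads μ) (z : ℤ) :
    z ∈ beads (removeAll n r μ) ↔ swapFun n r z ∈ beads μ := by
  constructor
  · rintro ⟨i, rfl⟩
    rw [rowLen_removeAll]
    split_ifs with hi
    · rw [swapFun_of_dvd_succ (by
        rw [show (μ.rowLen i - 1 - i - 1 : ℤ) + 1 = μ.rowLen i - i - 1 by ring]; exact hi.2)]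
      exact ⟨i, by ring⟩
    · rw [sub_zero]
      have hmem : (μ.rowLen i - i - 1 : ℤ) ∈ beads μ := ⟨i, rfl⟩
      by_cases h1 : (n : ℤ) ∣ (μ.rowLen i - i - 1 : ℤ) + 1 - (r : ℕ)
      · rw [swapFun_of_dvd_succ h1]
        exact h _ hmem h1
      by_cases h2 : (n : ℤ) ∣ (μ.rowLen i - i - 1 : ℤ) - (r : ℕ)
      · rw [swapFun_of_dvd hn h2]
        by_contra h3
        exact hi ⟨h3, h2⟩
      · rwa [swapFun_of_not_dvd h1 h2]
  · have keep : ∀ y ∈ beads μ, (y - 1 ∈ beads μ ∨ ¬ (n : ℤ) ∣ y - (r : ℕ)) →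
        y ∈ beads (removeAll n r μ) := by
      rintro _ ⟨i, rfl⟩ hy
      refine ⟨i, ?_⟩
      rw [rowLen_removeAll, if_neg (by tauto), sub_zero]
    intro hz
    by_cases h2 : (n : ℤ) ∣ z - (r : ℕ)
    · rw [swapFun_of_dvd hn h2] at hz
      have h3 := h _ hz (by rwa [sub_add_cancel])
      rw [sub_add_cancel] at h3
      exact keep z h3 (Or.inl hz)
    by_cases h1 : (n : ℤ) ∣ z + 1 - (r : ℕ)
    · rw [swapFun_of_dvd_succ h1] at hz
      by_cases h3 : z ∈ beads μ
      · exact keep z h3 (Or.inr h2)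
      · obtain ⟨i, hi⟩ := hz
        refine ⟨i, ?_⟩
        rw [rowLen_removeAll, ← hi, add_sub_cancel_right, if_pos ⟨h3, h1⟩]
        linarith
    · rw [swapFun_of_not_dvd h1 h2] at hz
      exact keep z hz (Or.inr h2)

theorem mem_beads_coreStep {n : ℕ} (hn : 2 ≤ n) {r : Fin n} {μ : YoungDiagram}
    (hflush : ∀ z ∈ beads μ, ∀ k : ℕ, z - n * k ∈ beads μ) (z : ℤ) :
    z ∈ beads (coreStep n r μ) ↔ swapFun n r z ∈ beads μ := by
  rw [coreStep]
  split_ifs with h1 h2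
  · apply mem_beads_addAll hn
    obtain ⟨⟨i, j⟩, hij⟩ := h1
    obtain ⟨-, h2, h3⟩ := mem_addableCells_iff.mp hij
    have hmem : (μ.rowLen i - i - 1 : ℤ) ∈ beads μ := ⟨i, rfl⟩
    set y : ℤ := (μ.rowLen i - i - 1 : ℤ)
    intro z hz hzr
    obtain ⟨k, hk⟩ := dvd_sub h3 hzr
    have hk' : y + 1 - z = n * k := by linarith
    rcases le_total 0 k with hk0 | hk0
    · obtain ⟨k, rfl⟩ := Int.eq_ofNat_of_zero_le hk0
      have := hflush y hmem k
      rwa [show z - 1 = y - n * k by linarith]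
    · obtain ⟨l, hl⟩ := Int.eq_ofNat_of_zero_le (neg_nonneg.mpr hk0)
      exfalso
      apply h2
      have := hflush z hz l
      rwa [show y + 1 = z - n * l by rw [← hl]; linarith]
  all_goals
    have hadd : ∀ z ∈ beads μ, (n : ℤ) ∣ z + 1 - (r : ℕ) → z + 1 ∈ beads μ := by
      rintro _ ⟨i, rfl⟩ hz
      by_contra h3
      exact h1 ⟨_, mem_addableCells_iff.mpr ⟨rfl, h3, hz⟩⟩
  · exact mem_beads_removeAll hn hadd z
  · have hrem : ∀ z ∈ beads μ, (n : ℤ) ∣ z - (r : ℕ) → z - 1 ∈ beads μ := by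
      rintro _ ⟨i, rfl⟩ hz
      by_contra h3
      have hpos : μ.rowLen i ≠ 0 := by
        intro h0
        apply h3
        have := μ.rowLen_anti i (i + 1) (by omega)
        exact ⟨i + 1, by omega⟩
      exact h2 ⟨(i, μ.rowLen i - 1), mem_removableCells_iff.mpr ⟨by omega, h3, hz⟩⟩
    by_cases hz1 : (n : ℤ) ∣ z + 1 - (r : ℕ)
    · rw [swapFun_of_dvd_succ hz1]
      refine ⟨fun h => hadd z h hz1, fun h => ?_⟩
      simpa using hrem _ h hz1
    by_cases hz2 : (n : ℤ) ∣ z - (r : ℕ)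
    · rw [swapFun_of_dvd hn hz2]
      refine ⟨fun h => hrem z h hz2, fun h => ?_⟩
      simpa using hadd _ h (by rwa [sub_add_cancel])
    · rw [swapFun_of_not_dvd hz1 hz2]

theorem affPerm_mem_beads {n : ℕ} (hn : 2 ≤ n) (ω : List (Fin n)) (z : ℤ) :
    affPerm hn ω z ∈ beads (ω.foldr (coreStep n) ⊥) ↔ z < 0 := by
  induction ω generalizing z with
  | nil => exact mem_beads_bot z
  | cons r ω ih =>
    rw [affPerm_cons, List.foldr_cons, mem_beads_coreStep hn, swapFun_invol hn r, ih]
    intro y hy k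
    obtain ⟨x, rfl⟩ := (affPerm hn ω).surjective y
    have h := add_mul_of_add (affPerm_add hn ω) x (-k)
    rw [mul_neg, ← sub_eq_add_neg, ← sub_eq_add_neg] at h
    rw [← h, ih]
    rw [ih] at hy
    have : (0 : ℤ) ≤ n * k := by positivity
    linarith

/-! ### The first hook length -/

theorem hookLength_zero_zero {μ : YoungDiagram} :
    hookLength μ (0, 0) = μ.rowLen 0 + μ.colLen 0 - 1 := by
  have h : (μ.cells.filter fun d => (d.1 = 0 ∧ 0 ≤ d.2) ∨ (d.2 = 0 ∧ 0 ≤ d.1))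
      = μ.row 0 ∪ μ.col 0 := by
    ext d
    simp only [Finset.mem_filter, Finset.mem_union, YoungDiagram.mem_row_iff,
      YoungDiagram.mem_col_iff, YoungDiagram.mem_cells]
    grind
  have hc := Finset.card_union_add_card_inter (μ.row 0) (μ.col 0)
  rw [← YoungDiagram.rowLen_eq_card, ← YoungDiagram.colLen_eq_card] at hc
  have hi : μ.row 0 ∩ μ.col 0 = μ.cells.filter fun d => d = (0, 0) := by
    ext ⟨a, b⟩
    simp only [Finset.mem_inter, Finset.mem_filter, YoungDiagram.mem_row_iff,
      YoungDiagram.mem_col_iff, YoungDiagram.mem_cells, Prod.mk.injEq]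
    tauto
  rw [hookLength]
  simp only
  rw [h]
  by_cases h0 : (0, 0) ∈ μ
  · have : μ.row 0 ∩ μ.col 0 = {(0, 0)} := by
      rw [hi]
      ext d
      simp only [Finset.mem_filter, YoungDiagram.mem_cells, Finset.mem_singleton]
      exact ⟨fun h => h.2, fun h => ⟨h ▸ h0, h⟩⟩
    rw [this, Finset.card_singleton] at hc
    omega
  · have h1 : μ.rowLen 0 = 0 := by
      by_contra h
      exact h0 (YoungDiagram.mem_iff_lt_rowLen.mpr (Nat.pos_of_ne_zero h))
    have h2 : μ.colLen 0 = 0 := by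
      by_contra h
      exact h0 (YoungDiagram.mem_iff_lt_colLen.mpr (Nat.pos_of_ne_zero h))
    omega

theorem rowLen_pos_iff {μ : YoungDiagram} {i : ℕ} : 0 < μ.rowLen i ↔ i < μ.colLen 0 := by
  rw [← YoungDiagram.mem_iff_lt_rowLen, YoungDiagram.mem_iff_lt_colLen]

theorem exists_window {n : ℕ} (hn : 2 ≤ n) (z : ℤ) :
    ∃ (i : ℕ) (l : ℤ), i < n ∧ z = i + n * l := by
  have hpos : (0 : ℤ) < n := by omega
  refine ⟨(z % n).toNat, z / n, ?_, ?_⟩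
  · have := Int.emod_lt_of_pos z hpos
    omega
  · rw [Int.toNat_of_nonneg (Int.emod_nonneg z hpos.ne'), Int.emod_add_mul_ediv]

theorem hookLength_eq_iff {n m : ℕ} (hn : 2 ≤ n) (hm : 1 ≤ m) (ω : List (Fin n))
    (hmono : ∀ i j : ℕ, i < j → j < n → affPerm hn ω i < affPerm hn ω j) :
    hookLength (ω.foldr (coreStep n) ⊥) (0, 0) = n * (m - 1) + 1 ↔
      affPerm hn ω (n - 1) = affPerm hn ω 0 + n * m + 1 := by
  set μ := ω.foldr (coreStep n) ⊥ with hμ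
  have hB := affPerm_mem_beads hn ω
  rw [← hμ] at hB
  have hshift := add_mul_of_add (affPerm_add hn ω)
  set φ := affPerm hn ω
  have hmono' : ∀ i j : ℕ, i ≤ j → j < n → φ i ≤ φ j := by
    intro i j h1 h2
    rcases h1.lt_or_eq with h | rfl
    · exact (hmono i j h h2).le
    · exact le_rfl
  have hlast : ((n - 1 : ℕ) : ℤ) = n - 1 := by omega
  have hn0 : (0 : ℤ) < n := by omega
  have hφ1 : φ (-1) = φ (n - 1) - n := by
    have := hshift (-1) 1
    rw [mul_one, show (-1 : ℤ) + n = n - 1 by ring] at this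
    linarith
  have hmax : (μ.rowLen 0 : ℤ) - 1 = φ (n - 1) - n := by
    apply le_antisymm
    · have h0 : (μ.rowLen 0 : ℤ) - 1 ∈ beads μ := ⟨0, by simp⟩
      obtain ⟨z, hz⟩ := φ.surjective ((μ.rowLen 0 : ℤ) - 1)
      rw [← hz, hB] at h0
      obtain ⟨i, l, hi, rfl⟩ := exists_window hn z
      rw [← hz, hshift, ← hlast]
      have := hmono' i (n - 1) (by omega) (by omega)
      have hl : l ≤ -1 := by
        by_contra hl
        have : (0 : ℤ) ≤ n * l := mul_nonneg hn0.le (by omega)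
        omega
      nlinarith
    · obtain ⟨i, hi⟩ := (hB (-1)).mpr (by norm_num)
      have := μ.rowLen_anti 0 i (Nat.zero_le _)
      omega
  have hmin : -(μ.colLen 0 : ℤ) = φ 0 := by
    apply le_antisymm
    · by_contra h
      have h0 : φ 0 ∉ beads μ := by rw [hB]; exact lt_irrefl _
      apply h0
      have hr := rowLen_pos_iff (μ := μ) (i := (-φ 0 - 1).toNat)
      exact ⟨(-φ 0 - 1).toNat, by omega⟩
    · have h0 : -(μ.colLen 0 : ℤ) ∉ beads μ := by
        rintro ⟨i, hi⟩
        have hr := rowLen_pos_iff (μ := μ) (i := i)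
        omega
      obtain ⟨z, hz⟩ := φ.surjective (-(μ.colLen 0 : ℤ))
      rw [← hz, hB, not_lt] at h0
      obtain ⟨i, l, hi, rfl⟩ := exists_window hn z
      rw [← hz, hshift]
      have := hmono' 0 i (by omega) hi
      have hl : 0 ≤ l := by
        by_contra hl
        have : (n : ℤ) * l ≤ n * (-1) := mul_le_mul_of_nonneg_left (by omega) hn0.le
        omega
      have : 0 ≤ (n : ℤ) * l := mul_nonneg hn0.le hl
      push_cast at *
      linarith
  rw [hookLength_zero_zero]
  have hr := rowLen_pos_iff (μ := μ) (i := 0)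
  obtain ⟨m, rfl⟩ : ∃ m', m = m' + 1 := ⟨m - 1, by omega⟩
  rw [Nat.add_sub_cancel]
  have e1 : (n : ℤ) * ((m + 1 : ℕ) : ℤ) = n * m + n := by push_cast; ring
  have e2 : ((n * m : ℕ) : ℤ) = n * m := by push_cast; ring
  have e3 : (0 : ℤ) ≤ n * m := by positivity
  rw [e1]
  omega

end

end ShiCore
namespace ShiCore

noncomputable section

/-! ### Coordinates -/

theorem val_neg_one {n : ℕ} [NeZero n] : ((-1 : Fin n) : ℕ) = n - 1 := by
  obtain ⟨k, rfl⟩ : ∃ k, n = k + 1 := Nat.exists_eq_succ_of_ne_zero (NeZero.ne n)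
  simp

theorem zero_lt_neg_one {n : ℕ} [NeZero n] (hn : 2 ≤ n) : (0 : Fin n) < -1 := by
  rw [Fin.lt_def, val_neg_one, Fin.val_zero]
  omega

/-- The orthogonal projection to `V` of the vector with coordinates `g`. -/
def ofFun {n : ℕ} (g : Fin n → ℝ) : V n :=
  ⟨WithLp.toLp 2 fun i => g i - (∑ k, g k) / n, by
    change ∑ i, (g i - (∑ k, g k) / n) = 0
    rw [Finset.sum_sub_distrib, Finset.sum_const, Finset.card_univ, Fintype.card_fin, nsmul_eq_mul]
    rcases Nat.eq_zero_or_pos n with rfl | h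
    · simp
    · field_simp
      simp⟩

theorem ofFun_sub {n : ℕ} (g : Fin n → ℝ) (i j : Fin n) :
    (ofFun g).1 i - (ofFun g).1 j = g i - g j := by
  simp [ofFun]

theorem continuous_coord_sub {n : ℕ} (i j : Fin n) :
    Continuous fun v : V n => v.1 i - v.1 j := by fun_prop

theorem mem_hyperplane_root {n : ℕ} {i j : Fin n} {k : ℤ} {v : V n} :
    v ∈ hyperplane (root i j) k ↔ v.1 i - v.1 j = k := by
  rw [hyperplane, Set.mem_ofPred_eq, inner_root]

theorem mem_halfPos_root {n : ℕ} {i j : Fin n} {k : ℤ} {v : V n} :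
    v ∈ halfPos (root i j) k ↔ k ≤ v.1 i - v.1 j := by
  rw [halfPos, Set.mem_ofPred_eq, inner_root]

theorem mem_halfNeg_root {n : ℕ} {i j : Fin n} {k : ℤ} {v : V n} :
    v ∈ halfNeg (root i j) k ↔ v.1 i - v.1 j ≤ k := by
  rw [halfNeg, Set.mem_ofPred_eq, inner_root]

theorem mem_dominantChamber {n : ℕ} [NeZero n] {v : V n} :
    v ∈ dominantChamber n ↔ ∀ i : Fin n, i ≠ 0 → v.1 i ≤ v.1 (i - 1) := by
  simp only [dominantChamber, Set.mem_iInter, Subtype.forall, simpleRoot, mem_halfPos_root,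
    Int.cast_zero, sub_nonneg]

theorem antitone_of_mem_dominantChamber {n : ℕ} [NeZero n] {v : V n} (h : v ∈ dominantChamber n)
    {i j : Fin n} (hij : i ≤ j) : v.1 j ≤ v.1 i := by
  rw [mem_dominantChamber] at h
  obtain ⟨d, hd⟩ : ∃ d : ℕ, (j : ℕ) = i + d := ⟨j - i, by have := Fin.le_def.mp hij; omega⟩
  clear hij
  induction d generalizing j with
  | zero => rw [Fin.ext hd]
  | succ d ih =>
    have hj : j ≠ 0 := by
      rintro rfl
      rw [Fin.val_zero] at hd
      omega
    exact (h j hj).trans (ih (by rw [Fin.val_sub_one_of_ne_zero hj]; omega))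

theorem isClosed_dominantChamber {n : ℕ} [NeZero n] : IsClosed (dominantChamber n) := by
  have : dominantChamber n = ⋂ i : Fin n, {v | i ≠ 0 → 0 ≤ v.1 (i - 1) - v.1 i} := by
    ext v
    simp [mem_dominantChamber]
  rw [this]
  refine isClosed_iInter fun i => ?_
  by_cases hi : i = 0
  · simp [hi]
  · simpa only [hi, ne_eq, not_false_eq_true, forall_const] using
      isClosed_le continuous_const (continuous_coord_sub (i - 1) i)

/-! ### The quasi-periodic extension of a vector -/

/-- The extension of the coordinates of `x` to `ℤ` with `f (z + n) = f z - 1`. -/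
def affExt {n : ℕ} [NeZero n] (x : V n) (z : ℤ) : ℝ :=
  x.1 (Fin.ofNat n (z % n).toNat) - ((z / n : ℤ) : ℝ)

theorem affExt_add_mul {n : ℕ} [NeZero n] (x : V n) (z l : ℤ) :
    affExt x (z + n * l) = affExt x z - l := by
  have hn : (n : ℤ) ≠ 0 := by exact_mod_cast NeZero.ne n
  rw [affExt, affExt, Int.add_mul_emod_self_left, Int.add_mul_ediv_left _ _ hn]
  push_cast
  ring

theorem affExt_coe {n : ℕ} [NeZero n] (x : V n) (i : Fin n) : affExt x (i : ℕ) = x.1 i := by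
  have h1 : ((i : ℕ) : ℤ) % n = (i : ℕ) := Int.emod_eq_of_lt (by omega) (by omega)
  have h2 : ((i : ℕ) : ℤ) / n = 0 := Int.ediv_eq_zero_of_lt (by omega) (by omega)
  rw [affExt, h1, h2, Int.toNat_natCast, Fin.ofNat_val_eq_self]
  simp

theorem reflFun_apply {n : ℕ} [NeZero n] (r : Fin n) (x : V n) (i : Fin n) :
    (reflFun r x).1 i = x.1 i - (x.1 (r - 1) - x.1 r - reflLevel r) *
      ((if i = r - 1 then 1 else 0) - (if i = r then 1 else 0)) := by
  simp only [reflFun, simpleRoot, inner_root, Submodule.coe_sub, Submodule.coe_smul,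
    PiLp.sub_apply, PiLp.smul_apply, root_apply, smul_eq_mul]

theorem val_sub_one_add_one {n : ℕ} [NeZero n] (r : Fin n) :
    (((r - 1 : Fin n) : ℕ) : ℤ) + 1 = (r : ℕ) + n * (if r = 0 then 1 else 0) := by
  have hn := Nat.pos_of_ne_zero (NeZero.ne n)
  split_ifs with h
  · subst h
    rw [zero_sub, val_neg_one, Fin.val_zero]
    omega
  · rw [Fin.val_sub_one_of_ne_zero h]
    have : (r : ℕ) ≠ 0 := fun h0 => h (Fin.ext h0)
    omega

theorem dvd_sub_iff {n : ℕ} (i r : Fin n) : (n : ℤ) ∣ ((i : ℕ) : ℤ) - (r : ℕ) ↔ i = r := by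
  constructor
  · intro h
    have := Int.eq_zero_of_abs_lt_dvd h (by rw [abs_lt]; omega)
    exact Fin.ext (by omega)
  · rintro rfl
    simp

theorem affExt_reflFun {n : ℕ} [NeZero n] (hn : 2 ≤ n) (r : Fin n) (x : V n) (z : ℤ) :
    affExt (reflFun r x) z = affExt x (swapFun n r z) := by
  have hne := sub_one_ne (by omega : n ≠ 1) r
  have hr := val_sub_one_add_one r
  have key : ∀ i : Fin n, affExt (reflFun r x) (i : ℕ) = affExt x (swapFun n r (i : ℕ)) := by
    intro i
    rw [affExt_coe, reflFun_apply]
    by_cases h1 : i = r - 1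
    · subst h1
      rw [swapFun_of_dvd_succ, hr, affExt_add_mul, affExt_coe, if_pos rfl, if_neg hne, reflLevel]
      · split_ifs <;> push_cast <;> ring
      · rw [hr, add_sub_cancel_left]
        exact dvd_mul_right _ _
    have h3 : ¬ (n : ℤ) ∣ ((i : ℕ) : ℤ) + 1 - (r : ℕ) := by
      intro h
      apply h1
      rw [← dvd_sub_iff]
      have h' : (n : ℤ) ∣ (((r - 1 : Fin n) : ℕ) : ℤ) + 1 - (r : ℕ) := by
        rw [hr, add_sub_cancel_left]
        exact dvd_mul_right _ _
      have h'' := dvd_sub h h'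
      rwa [sub_sub_sub_cancel_right, add_sub_add_right_eq_sub] at h''
    by_cases h2 : i = r
    · subst h2
      have e : ((i : ℕ) : ℤ) - 1 = ((i - 1 : Fin n) : ℕ) + n * (-(if i = 0 then 1 else 0)) := by
        linarith
      rw [swapFun_of_dvd hn (by simp), e, affExt_add_mul, affExt_coe, if_pos rfl, if_neg h1,
        reflLevel]
      split_ifs <;> push_cast <;> ring
    · rw [swapFun_of_not_dvd h3 (by rwa [dvd_sub_iff]), affExt_coe, if_neg h1, if_neg h2]
      ring
  obtain ⟨i, l, hi, rfl⟩ := exists_window hn z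
  rw [add_mul_of_add (swapFun_add r), affExt_add_mul, affExt_add_mul]
  rw [key ⟨i, hi⟩]

theorem affExt_geomAction {n : ℕ} [NeZero n] (hn : 2 ≤ n) (ω : List (Fin n)) (x : V n) (z : ℤ) :
    affExt (geomAction n ((affSystem n).wordProd ω)⁻¹ x) z = affExt x (affPerm hn ω z) := by
  induction ω generalizing x with
  | nil => simp [affPerm_nil]
  | cons r ω ih =>
    have h : geomAction n ((affSystem n).simple r) = refl r :=
      (affSystem n).lift_apply_simple (refl_isLiftable n) r
    rw [CoxeterSystem.wordProd_cons, mul_inv_rev, CoxeterSystem.inv_simple, map_mul,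
      Equiv.Perm.mul_apply, ih, h, affPerm_cons]
    exact affExt_reflFun hn r x _

/-! ### The fundamental alcove -/

theorem affExt_antitone {n : ℕ} [NeZero n] (hn : 2 ≤ n) {x : V n}
    (hx : x ∈ fundamentalAlcove n) : Antitone (affExt x) := by
  obtain ⟨h1, h2⟩ := interior_subset hx
  rw [theta, mem_halfNeg_root] at h1
  rw [mem_dominantChamber] at h2
  apply antitone_int_of_succ_le
  intro z
  obtain ⟨i, l, hi, rfl⟩ := exists_window hn z
  rw [show (i : ℤ) + n * l + 1 = i + 1 + n * l by ring, affExt_add_mul, affExt_add_mul]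
  apply sub_le_sub_right
  have e := affExt_coe x ⟨i, hi⟩
  simp only at e
  rw [e]
  by_cases hi' : i + 1 < n
  · have e2 := affExt_coe x ⟨i + 1, hi'⟩
    push_cast at e2
    rw [e2]
    have hne : (⟨i + 1, hi'⟩ : Fin n) ≠ 0 := by
      intro h
      simpa using congrArg Fin.val h
    have hpred : (⟨i + 1, hi'⟩ : Fin n) - 1 = ⟨i, hi⟩ := by
      ext
      rw [Fin.val_sub_one_of_ne_zero hne]
      simp
    rw [← hpred]
    exact h2 _ hne
  · have e2 := affExt_add_mul x 0 1
    have e3 := affExt_coe x 0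
    rw [Fin.val_zero, Nat.cast_zero] at e3
    rw [show (i : ℤ) + 1 = 0 + n * 1 by omega, e2, e3]
    have : (⟨i, hi⟩ : Fin n) = -1 := by
      ext
      rw [val_neg_one]
      simp only
      omega
    rw [this]
    push_cast at *
    linarith

/-- The centre of the fundamental alcove. -/
def alcoveCenter (n : ℕ) : V n := ofFun fun i => -((i : ℕ) : ℝ) / n

theorem affExt_alcoveCenter {n : ℕ} [NeZero n] (hn : 2 ≤ n) (y z : ℤ) :
    affExt (alcoveCenter n) y - affExt (alcoveCenter n) z = ((z : ℝ) - y) / n := by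
  have hn0 : (n : ℝ) ≠ 0 := by exact_mod_cast NeZero.ne n
  have key : ∀ z : ℤ, affExt (alcoveCenter n) z = (alcoveCenter n).1 0 - z / n := by
    intro z
    obtain ⟨i, l, hi, rfl⟩ := exists_window hn z
    have h := ofFun_sub (fun i : Fin n => -((i : ℕ) : ℝ) / n) ⟨i, hi⟩ 0
    have e := affExt_coe (alcoveCenter n) ⟨i, hi⟩
    simp only at e
    rw [← alcoveCenter] at h
    rw [affExt_add_mul, e, eq_add_of_sub_eq h]
    simp only [Fin.val_zero]
    push_cast
    field_simp
    ring
  rw [key, key]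
  ring

theorem alcoveCenter_mem {n : ℕ} [NeZero n] (hn : 2 ≤ n) :
    alcoveCenter n ∈ fundamentalAlcove n := by
  have hn0 : (0 : ℝ) < n := by
    have := Nat.pos_of_ne_zero (NeZero.ne n)
    exact_mod_cast this
  let U : Set (V n) := {v | v.1 0 - v.1 (-1) < 1} ∩
    ⋂ i : Fin n, {v | i ≠ 0 → 0 < v.1 (i - 1) - v.1 i}
  have hU : IsOpen U := by
    refine (isOpen_lt (continuous_coord_sub 0 (-1)) continuous_const).inter
      (isOpen_iInter_of_finite fun i => ?_)
    by_cases hi : i = 0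
    · simp [hi]
    · simpa only [hi, ne_eq, not_false_eq_true, forall_const] using
        isOpen_lt continuous_const (continuous_coord_sub (i - 1) i)
  refine interior_maximal (s := halfNeg (theta n) 1 ∩ dominantChamber n) ?_ hU ?_
  · rintro v ⟨h1, h2⟩
    refine ⟨?_, ?_⟩
    · rw [theta, mem_halfNeg_root, Int.cast_one]
      exact le_of_lt h1
    · rw [mem_dominantChamber]
      intro i hi
      have := Set.mem_iInter.mp h2 i hi
      linarith
  · refine ⟨?_, Set.mem_iInter.mpr fun i hi => ?_⟩
    · change (alcoveCenter n).1 0 - (alcoveCenter n).1 (-1) < 1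
      rw [alcoveCenter, ofFun_sub, val_neg_one, Fin.val_zero, Nat.cast_sub (by omega)]
      push_cast
      have : (-0 / n - -(n - 1 : ℝ) / n : ℝ) = 1 - 1 / n := by field_simp; ring
      rw [this]
      have : (0 : ℝ) < 1 / n := by positivity
      linarith
    · rw [alcoveCenter, ofFun_sub, Fin.val_sub_one_of_ne_zero hi]
      have : 1 ≤ (i : ℕ) := Nat.one_le_iff_ne_zero.mpr fun h => hi (Fin.ext h)
      rw [Nat.cast_sub this]
      have : (-(((i : ℕ) : ℝ) - (1 : ℕ)) / n - -((i : ℕ) : ℝ) / n : ℝ) = 1 / n := by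
        push_cast
        ring
      rw [this]
      positivity

/-! ### Regions of the Shi arrangement -/

theorem shi_side {n m : ℕ} {R : Set (V n)} (hR : IsRegion (shiArrangement n m) R) {x y : V n}
    (hx : x ∈ R) (hy : y ∈ R) {i j : Fin n} (hij : i < j) {k : ℤ} (hk : -(m : ℤ) < k)
    (hk' : k ≤ m) : (k < x.1 i - x.1 j ∧ k < y.1 i - y.1 j) ∨
      (x.1 i - x.1 j < k ∧ y.1 i - y.1 j < k) := by
  obtain ⟨x₀, -, rfl⟩ := hR
  have hne : ∀ v ∈ connectedComponentIn (⋃₀ shiArrangement n m)ᶜ x₀, v.1 i - v.1 j ≠ k := by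
    intro v hv h
    exact connectedComponentIn_subset _ _ hv
      ⟨_, ⟨root i j, ⟨i, j, hij, rfl⟩, k, hk, hk', rfl⟩, mem_hyperplane_root.mpr h⟩
  have hc := isPreconnected_connectedComponentIn (F := (⋃₀ shiArrangement n m)ᶜ) (x := x₀)
  have hf := (continuous_coord_sub i j).continuousOn
    (s := connectedComponentIn (⋃₀ shiArrangement n m)ᶜ x₀)
  have hmix : ∀ a ∈ connectedComponentIn (⋃₀ shiArrangement n m)ᶜ x₀,
      ∀ b ∈ connectedComponentIn (⋃₀ shiArrangement n m)ᶜ x₀,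
      a.1 i - a.1 j < k → ¬ (k : ℝ) < b.1 i - b.1 j := by
    intro a ha b hb h1 h2
    obtain ⟨v, hv, hvk⟩ := hc.intermediate_value ha hb hf ⟨h1.le, h2.le⟩
    exact hne v hv hvk
  rcases lt_or_gt_of_ne (hne x hx) with h1 | h1 <;> rcases lt_or_gt_of_ne (hne y hy) with h2 | h2
  · exact Or.inr ⟨h1, h2⟩
  · exact absurd h2 (hmix x hx y hy h1)
  · exact absurd h1 (hmix y hy x hx h2)
  · exact Or.inl ⟨h1, h2⟩

theorem mem_region_of_shi_side {n m : ℕ} {R : Set (V n)} (hR : IsRegion (shiArrangement n m) R)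
    {x y : V n} (hx : x ∈ R)
    (h : ∀ i j : Fin n, i < j → ∀ k : ℤ, -(m : ℤ) < k → k ≤ m →
      (k < x.1 i - x.1 j ∧ k < y.1 i - y.1 j) ∨ (x.1 i - x.1 j < k ∧ y.1 i - y.1 j < k)) :
    y ∈ R := by
  obtain ⟨x₀, -, rfl⟩ := hR
  rw [connectedComponentIn_eq hx]
  refine (convex_segment x y).isPreconnected.subset_connectedComponentIn
    (left_mem_segment ℝ x y) ?_ (right_mem_segment ℝ x y)
  rintro v ⟨a, b, ha, hb, hab, rfl⟩ ⟨_, ⟨_, ⟨i, j, hij, rfl⟩, k, hk, hk', rfl⟩, hv⟩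
  rw [mem_hyperplane_root] at hv
  simp only [Submodule.coe_add, Submodule.coe_smul, PiLp.add_apply, PiLp.smul_apply,
    smul_eq_mul] at hv
  have hv' : a * (x.1 i - x.1 j - k) + b * (y.1 i - y.1 j - k) = 0 := by
    have hk1 : (k : ℝ) = (a + b) * k := by rw [hab, one_mul]
    linarith
  rcases h i j hij k hk hk' with ⟨h1, h2⟩ | ⟨h1, h2⟩
  · rcases ha.eq_or_lt with rfl | ha
    · rw [zero_add] at hab
      rw [hab] at hv'
      linarith
    · have := mul_pos ha (sub_pos.mpr h1)
      have := mul_nonneg hb (sub_pos.mpr h2).le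
      linarith
  · rcases ha.eq_or_lt with rfl | ha
    · rw [zero_add] at hab
      rw [hab] at hv'
      linarith
    · have := mul_pos ha (sub_pos.mpr h1)
      have := mul_nonneg hb (sub_pos.mpr h2).le
      linarith

theorem convex_region {n m : ℕ} {R : Set (V n)} (hR : IsRegion (shiArrangement n m) R) :
    Convex ℝ R := by
  rintro x hx y hy a b ha hb hab
  refine mem_region_of_shi_side hR hx fun i j hij k hk hk' => ?_
  have e : (a • x + b • y).1 i - (a • x + b • y).1 j
      = a * (x.1 i - x.1 j) + b * (y.1 i - y.1 j) := by
    simp only [Submodule.coe_add, Submodule.coe_smul, PiLp.add_apply, PiLp.smul_apply,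
      smul_eq_mul]
    ring
  rw [e]
  have hb' : b = 1 - a := by linarith
  have ha' : a ≤ 1 := by linarith
  subst hb'
  rcases shi_side hR hx hy hij hk hk' with ⟨h1, h2⟩ | ⟨h1, h2⟩
  · refine Or.inl ⟨h1, ?_⟩
    rcases ha.eq_or_lt with rfl | ha
    · simpa using h2
    · nlinarith [mul_pos ha (sub_pos.mpr h1), mul_nonneg hb (sub_pos.mpr h2).le]
  · refine Or.inr ⟨h1, ?_⟩
    rcases ha.eq_or_lt with rfl | ha
    · simpa using h2
    · nlinarith [mul_pos ha (sub_pos.mpr h1), mul_nonneg hb (sub_pos.mpr h2).le]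

/-- The affine hyperplane `⟨v, α⟩ = c` as an affine subspace. -/
def levelSubspace {n : ℕ} (α : V n) (c : ℝ) : AffineSubspace ℝ (V n) where
  carrier := {v | inner ℝ v α = c}
  smul_vsub_vadd_mem' := by
    intro a p₁ p₂ p₃ h1 h2 h3
    simp only [Set.mem_ofPred_eq] at *
    rw [vsub_eq_sub, vadd_eq_add, inner_add_left, inner_smul_V, inner_sub_left, h1, h2, h3]
    ring

theorem mem_levelSubspace_root {n : ℕ} {i j : Fin n} {c : ℝ} {v : V n} :
    v ∈ levelSubspace (root i j) c ↔ v.1 i - v.1 j = c := by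
  change inner ℝ v (root i j) = c ↔ _
  rw [inner_root]

theorem exists_facet_point {n : ℕ} {R : Set (V n)} (hR : Convex ℝ R) {i l : Fin n} {k : ℤ}
    (hspan : (affineSpan ℝ (closure R ∩ hyperplane (root i l) k) : Set (V n))
      = hyperplane (root i l) k) {j : Fin n} (hil : i ≠ l) (hij : i ≠ j) (hjl : j ≠ l) :
    ∃ p ∈ closure R ∩ hyperplane (root i l) k, ∀ z : ℤ, p.1 i - p.1 j ≠ z := by
  by_contra! hcon
  set S := closure R ∩ hyperplane (root i l) k with hS
  have hconv : Convex ℝ S := by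
    have : Convex ℝ (hyperplane (root i l) k) := (levelSubspace (root i l) k).convex
    exact hR.closure.inter this
  have hle : ∀ p ∈ S, ∀ q ∈ S, p.1 i - p.1 j ≤ q.1 i - q.1 j := by
    intro p hp q hq
    by_contra! hlt
    obtain ⟨a, ha⟩ := hcon p hp
    obtain ⟨b, hb⟩ := hcon q hq
    rw [ha, hb] at hlt
    have hlt' : b < a := Int.cast_lt.mp hlt
    have hlt'' : (b : ℝ) + 1 ≤ a := by exact_mod_cast Int.add_one_le_iff.mpr hlt'
    obtain ⟨v, hv, hve⟩ := hconv.isPreconnected.intermediate_value hq hp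
      (continuous_coord_sub i j).continuousOn
      (show (b : ℝ) + 1 / 2 ∈ Set.Icc _ _ by rw [ha, hb]; constructor <;> linarith)
    obtain ⟨c, hc⟩ := hcon v hv
    simp only at hve
    rw [hc] at hve
    have h1 : (2 * c : ℤ) = 2 * b + 1 := by
      have : (2 * c : ℝ) = 2 * b + 1 := by linarith
      exact_mod_cast this
    omega
  have hne : S.Nonempty := by
    rw [← affineSpan_nonempty ℝ, hspan]
    refine ⟨(k : ℝ) • ofFun fun a => if a = i then 1 else 0, ?_⟩
    rw [mem_hyperplane_root, Submodule.coe_smul, PiLp.smul_apply, PiLp.smul_apply, ← smul_sub,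
      ofFun_sub, if_pos rfl, if_neg hil.symm]
    simp
  obtain ⟨p, hp⟩ := hne
  have hsub : affineSpan ℝ S ≤ levelSubspace (root i j) (p.1 i - p.1 j) := by
    rw [affineSpan_le]
    intro q hq
    exact mem_levelSubspace_root.mpr (le_antisymm (hle q hq p hp) (hle p hp q hq))
  let d : V n := ofFun fun a => if a = j then 1 else 0
  have hd : ∀ a b, d.1 a - d.1 b = (if a = j then 1 else 0) - (if b = j then 1 else 0) :=
    fun a b => ofFun_sub _ a b
  have hpd : p + d ∈ hyperplane (root i l) k := by
    have h1 := mem_hyperplane_root.mp hp.2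
    have h2 := hd i l
    rw [if_neg hij, if_neg hjl.symm] at h2
    rw [mem_hyperplane_root, Submodule.coe_add, PiLp.add_apply, PiLp.add_apply]
    linarith
  rw [← hspan] at hpd
  have h1 := mem_levelSubspace_root.mp (hsub hpd)
  have h2 := hd i j
  rw [if_neg hij, if_pos rfl] at h2
  rw [Submodule.coe_add, PiLp.add_apply, PiLp.add_apply] at h1
  linarith

end

end ShiCore
namespace ShiCore

noncomputable section

/-! ### The wall `H_{θ,m}` -/

theorem fin_pair_of_two {n : ℕ} [NeZero n] (h2 : n = 2) {i j : Fin n} (hij : i < j) :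
    i = 0 ∧ j = -1 := by
  have := Fin.lt_def.mp hij
  constructor <;> ext
  · rw [Fin.val_zero]
    omega
  · rw [val_neg_one]
    omega

theorem alcoveCenter_theta {n : ℕ} [NeZero n] (hn : 2 ≤ n) :
    (alcoveCenter n).1 0 - (alcoveCenter n).1 (-1) = 1 - 1 / n := by
  have hn0 : (n : ℝ) ≠ 0 := by exact_mod_cast NeZero.ne n
  have := affExt_alcoveCenter hn ((0 : Fin n) : ℕ) ((-1 : Fin n) : ℕ)
  rw [affExt_coe, affExt_coe] at this
  rw [this, val_neg_one, Fin.val_zero, Nat.cast_sub (by omega)]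
  push_cast
  field_simp
  ring

theorem floors_of_wall {n m : ℕ} [NeZero n] (hn : 2 ≤ n) {R : Set (V n)}
    (hR : IsDominantRegion n m R)
    (hW : IsWall (shiArrangement n m) (hyperplane (theta n) m) R) {j : Fin n} (h0 : 0 < j)
    (h1 : j < -1) {x : V n} (hx : x ∈ R) :
    ∃ k : ℤ, k < x.1 0 - x.1 j ∧ x.1 0 - x.1 j < k + 1 ∧
      m - 1 - k < x.1 j - x.1 (-1) ∧ x.1 j - x.1 (-1) < m - k := by
  obtain ⟨p, ⟨hpR, hpH⟩, hp⟩ := exists_facet_point (convex_region hR.1) hW.2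
    (zero_lt_neg_one hn).ne h0.ne h1.ne
  have hpd := closure_minimal hR.2 isClosed_dominantChamber hpR
  have hp0 := antitone_of_mem_dominantChamber hpd h0.le
  have hp1 := antitone_of_mem_dominantChamber hpd h1.le
  rw [mem_hyperplane_root, Int.cast_natCast] at hpH
  have hk1 : (⌊p.1 0 - p.1 j⌋ : ℝ) < p.1 0 - p.1 j :=
    lt_of_le_of_ne (Int.floor_le _) fun h => hp _ h.symm
  have hk2 := Int.lt_floor_add_one (p.1 0 - p.1 j)
  have hk0 : 0 ≤ ⌊p.1 0 - p.1 j⌋ := Int.floor_nonneg.mpr (by linarith)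
  set k := ⌊p.1 0 - p.1 j⌋
  have hkm : k < m := by
    have : (k : ℝ) < m := by linarith
    exact_mod_cast this
  let U : Set (V n) := ({v | (k : ℝ) < v.1 0 - v.1 j} ∩ {v | v.1 0 - v.1 j < k + 1}) ∩
    ({v | (m : ℝ) - 1 - k < v.1 j - v.1 (-1)} ∩ {v | v.1 j - v.1 (-1) < m - k})
  have hU : IsOpen U :=
    ((isOpen_lt continuous_const (continuous_coord_sub _ _)).inter
      (isOpen_lt (continuous_coord_sub _ _) continuous_const)).inter
    ((isOpen_lt continuous_const (continuous_coord_sub _ _)).inter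
      (isOpen_lt (continuous_coord_sub _ _) continuous_const))
  obtain ⟨y, ⟨⟨hy1, hy2⟩, hy3, hy4⟩, hyR⟩ := mem_closure_iff.mp hpR U hU
    ⟨⟨hk1, hk2⟩, by rw [Set.mem_ofPred_eq]; linarith, by rw [Set.mem_ofPred_eq]; linarith⟩
  simp only [Set.mem_ofPred_eq] at hy1 hy2 hy3 hy4
  have s1 := shi_side hR.1 hyR hx h0 (k := k) (by omega) (by omega)
  have s2 := shi_side hR.1 hyR hx h0 (k := k + 1) (by omega) (by omega)
  have s3 := shi_side hR.1 hyR hx h1 (k := m - 1 - k) (by omega) (by omega)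
  have s4 := shi_side hR.1 hyR hx h1 (k := m - k) (by omega) (by omega)
  push_cast at s2 s3 s4
  refine ⟨k, ?_, ?_, ?_, ?_⟩
  · rcases s1 with s | s <;> linarith [s.1, s.2]
  · rcases s2 with s | s <;> linarith [s.1, s.2]
  · rcases s3 with s | s <;> linarith [s.1, s.2]
  · rcases s4 with s | s <;> linarith [s.1, s.2]

open Topology in
theorem affineSpan_wall {n m : ℕ} [NeZero n] (hn : 2 ≤ n) {R : Set (V n)}
    (hR : IsRegion (shiArrangement n m) R) {q : V n} (hq : q ∈ R) {a : Fin n → ℤ}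
    (hqa : ∀ i j, q.1 i - q.1 j = ((a j : ℝ) - a i) / n)
    (ha : ∀ i j, i ≠ j → ¬ (n : ℤ) ∣ a j - a i) (hm : a (-1) = a 0 + n * m + 1) :
    (affineSpan ℝ (closure R ∩ hyperplane (theta n) m) : Set (V n)) = hyperplane (theta n) m := by
  have hn0 : (0 : ℝ) < n := by exact_mod_cast (by omega : 0 < n)
  have h0l := (zero_lt_neg_one hn).ne
  set u : ℝ := 1 / n with hu
  have hu0 : 0 < u := by positivity
  have hgap : ∀ i j, i ≠ j → ∀ k : ℤ, u ≤ q.1 i - q.1 j - k ∨ q.1 i - q.1 j - k ≤ -u := by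
    intro i j hij k
    have e : q.1 i - q.1 j - k = ((a j - a i - n * k : ℤ) : ℝ) * u := by
      rw [hqa, hu]
      push_cast
      field_simp
    have hne : a j - a i - n * k ≠ 0 := fun h => ha i j hij ⟨k, by linarith⟩
    rw [e]
    rcases lt_or_gt_of_ne hne with h | h
    · right
      have : ((a j - a i - n * k : ℤ) : ℝ) ≤ -1 := by exact_mod_cast Int.le_sub_one_of_lt h
      nlinarith
    · left
      have : (1 : ℝ) ≤ ((a j - a i - n * k : ℤ) : ℝ) := by exact_mod_cast h
      nlinarith
  have hqθ : q.1 0 - q.1 (-1) = m + u := by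
    rw [hqa, hm, hu]
    push_cast
    field_simp
    ring
  let e : V n := ofFun fun i => (if i = 0 then 1 else 0) - (if i = -1 then 1 else 0)
  have he : ∀ i j, e.1 i - e.1 j = ((if i = 0 then 1 else 0) - (if i = -1 then 1 else 0)) -
      ((if j = 0 then 1 else 0) - (if j = -1 then 1 else 0)) := fun i j => ofFun_sub _ i j
  have heθ : e.1 0 - e.1 (-1) = 2 := by
    rw [he, if_pos rfl, if_neg h0l, if_neg h0l.symm, if_pos rfl]
    norm_num
  have hcoord : ∀ (x y : V n) (t : ℝ) (i j : Fin n), (x + t • y).1 i - (x + t • y).1 j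
      = (x.1 i - x.1 j) + t * (y.1 i - y.1 j) := by
    intro x y t i j
    simp only [Submodule.coe_add, Submodule.coe_smul, PiLp.add_apply, PiLp.smul_apply,
      smul_eq_mul]
    ring
  set p : V n := q + (-(u / 2)) • e with hp
  let O : Set (V n) := ⋂ i : Fin n, ⋂ j : Fin n,
    {y | |(y.1 i - y.1 j) - (p.1 i - p.1 j)| < u / 4}
  have hO : IsOpen O := isOpen_iInter_of_finite fun i => isOpen_iInter_of_finite fun j =>
    isOpen_lt ((continuous_coord_sub i j).sub continuous_const).abs continuous_const
  have hpO : p ∈ O := by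
    simp only [O, Set.mem_iInter, Set.mem_ofPred_eq, sub_self, abs_zero]
    intro _ _
    linarith
  have hOR : ∀ y ∈ O, (m : ℝ) < y.1 0 - y.1 (-1) → y ∈ R := by
    intro y hy hym
    refine mem_region_of_shi_side hR hq fun i j hij k hk hk' => ?_
    have hi : i ≠ -1 := by
      rintro rfl
      have := Fin.lt_def.mp hij
      rw [val_neg_one] at this
      omega
    have hj : j ≠ 0 := by
      rintro rfl
      have := Fin.lt_def.mp hij
      rw [Fin.val_zero] at this
      omega
    by_cases hθ : i = 0 ∧ j = -1
    · obtain ⟨rfl, rfl⟩ := hθ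
      have : (k : ℝ) ≤ m := by exact_mod_cast hk'
      left
      constructor <;> linarith
    · have h1 : |(y.1 i - y.1 j) - (p.1 i - p.1 j)| < u / 4 :=
        Set.mem_iInter.mp (Set.mem_iInter.mp hy i) j
      have h2 := he i j
      rw [if_neg hi, if_neg hj] at h2
      have h3 : 0 ≤ e.1 i - e.1 j ∧ e.1 i - e.1 j ≤ 1 := by
        rw [h2]
        by_cases h4 : i = 0
        · rw [if_pos h4, if_neg fun h => hθ ⟨h4, h⟩]
          norm_num
        · rw [if_neg h4]
          split_ifs <;> norm_num
      rw [hp, hcoord, abs_lt] at h1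
      have h4 := mul_le_mul_of_nonneg_left h3.2 hu0.le
      have h5 := mul_nonneg hu0.le h3.1
      rcases hgap i j hij.ne k with h | h
      · left
        constructor <;> linarith
      · right
        constructor <;> linarith
  have hOcl : ∀ y ∈ O, y.1 0 - y.1 (-1) = m → y ∈ closure R := by
    intro y hy hym
    have hc : Filter.Tendsto (fun t : ℝ => y + t • e) (𝓝[>] 0) (𝓝 y) := by
      have : Continuous fun t : ℝ => y + t • e := by fun_prop
      have := this.tendsto 0
      rw [zero_smul, add_zero] at this
      exact this.mono_left nhdsWithin_le_nhds
    refine mem_closure_of_tendsto hc ?_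
    filter_upwards [hc (hO.mem_nhds hy), self_mem_nhdsWithin] with t ht ht0
    refine hOR _ ht ?_
    rw [hcoord, heθ, hym]
    have : 0 < t := ht0
    linarith
  have hpθ : p.1 0 - p.1 (-1) = m := by
    rw [hp, hcoord, heθ, hqθ]
    ring
  apply Set.Subset.antisymm
  · have : affineSpan ℝ (closure R ∩ hyperplane (theta n) m) ≤ levelSubspace (theta n) m :=
      affineSpan_le.mpr fun v hv => by
        have := mem_hyperplane_root.mp hv.2
        rw [Int.cast_natCast] at this
        exact mem_levelSubspace_root.mpr this
    intro v hv
    have := this hv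
    rw [theta, mem_levelSubspace_root] at this
    rw [theta, mem_hyperplane_root, this, Int.cast_natCast]
  · intro h hh
    rw [theta, mem_hyperplane_root, Int.cast_natCast] at hh
    have hc : Filter.Tendsto (fun t : ℝ => p + t • (h - p)) (𝓝[>] 0) (𝓝 p) := by
      have : Continuous fun t : ℝ => p + t • (h - p) := by fun_prop
      have := this.tendsto 0
      rw [zero_smul, add_zero] at this
      exact this.mono_left nhdsWithin_le_nhds
    obtain ⟨s, hsO, hs0⟩ := ((hc.eventually (hO.mem_nhds hpO)).and
      (self_mem_nhdsWithin (a := (0 : ℝ)) (s := Set.Ioi 0))).exists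
    have hs0' : s ≠ 0 := ne_of_gt hs0
    have hsθ : (p + s • (h - p)).1 0 - (p + s • (h - p)).1 (-1) = m := by
      rw [hcoord, hpθ, Submodule.coe_sub, PiLp.sub_apply, PiLp.sub_apply]
      linear_combination s * (hh - hpθ)
    have hmem : ∀ y ∈ O, y.1 0 - y.1 (-1) = m →
        y ∈ affineSpan ℝ (closure R ∩ hyperplane (theta n) m) := fun y hy hym =>
      subset_affineSpan ℝ _ ⟨hOcl y hy hym, by
        rw [theta, mem_hyperplane_root, hym, Int.cast_natCast]⟩
    have := AffineMap.lineMap_mem s⁻¹ (hmem p hpO hpθ) (hmem _ hsO hsθ)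
    rw [AffineMap.lineMap_apply, vsub_eq_sub, vadd_eq_add, add_sub_cancel_left, smul_smul,
      inv_mul_cancel₀ hs0', one_smul, sub_add_cancel] at this
    exact this

theorem encard_image_Icc {α : Type*} (x : α) (k : ℕ) :
    ((fun z : ℤ => (x, z)) '' Set.Icc 1 (k : ℤ)).encard = k := by
  rw [Function.Injective.encard_image (fun a b h => (Prod.ext_iff.mp h).2), ← Finset.coe_Icc,
    Set.encard_coe_eq_coe_finsetCard, Int.card_Icc]
  simp

theorem level_le_of_minimal {n m : ℕ} [NeZero n] (hn : n = 2) {R A : Set (V n)}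
    (hR : IsRegion (shiArrangement n m) R) (hA : IsMinimalAlcove n R A) {x : V n} (hx : x ∈ R)
    (hxm : (m : ℝ) < x.1 0 - x.1 (-1)) {L : ℤ} (hL : A ⊆ halfPos (theta n) L) : L ≤ m := by
  by_contra! hlt
  have h01 := zero_lt_neg_one hn.ge
  let b : V n := ofFun fun i => if i = 0 then (m : ℝ) + 1 / 2 else 0
  have hb : b.1 0 - b.1 (-1) = m + 1 / 2 := by
    have := ofFun_sub (fun i : Fin n => if i = 0 then (m : ℝ) + 1 / 2 else 0) 0 (-1)
    rw [if_pos rfl, if_neg h01.ne', sub_zero] at this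
    exact this
  have hbc : b ∈ (⋃₀ affineArrangement n)ᶜ := by
    rintro ⟨_, ⟨_, ⟨i, j, hij, rfl⟩, k, rfl⟩, h⟩
    obtain ⟨rfl, rfl⟩ := fin_pair_of_two hn hij
    rw [mem_hyperplane_root, hb] at h
    have h1 : (2 * m + 1 : ℤ) = 2 * k := by
      have : (2 * m + 1 : ℝ) = 2 * k := by linarith
      exact_mod_cast this
    omega
  have hbR : b ∈ R := by
    refine mem_region_of_shi_side hR hx fun i j hij k hk hk' => ?_
    obtain ⟨rfl, rfl⟩ := fin_pair_of_two hn hij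
    have : (k : ℝ) ≤ m := by exact_mod_cast hk'
    left
    constructor <;> linarith
  have hsub : connectedComponentIn (⋃₀ affineArrangement n)ᶜ b ⊆ R := by
    obtain ⟨x₀, -, rfl⟩ := hR
    rw [connectedComponentIn_eq hbR]
    apply connectedComponentIn_mono
    apply Set.compl_subset_compl.mpr
    apply Set.sUnion_subset_sUnion
    rintro _ ⟨α, hα, k, -, -, rfl⟩
    exact ⟨α, hα, k, rfl⟩
  have hbB := mem_connectedComponentIn hbc
  have hc := alcoveCenter_mem hn.ge
  have hcθ := alcoveCenter_theta hn.ge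
  rw [show (n : ℝ) = 2 by exact_mod_cast hn] at hcθ
  have hdist := hA.2.2 _ ⟨b, hbc, rfl⟩ hsub
  have hB : alcoveDist (connectedComponentIn (⋃₀ affineArrangement n)ᶜ b) (fundamentalAlcove n)
      ≤ m := by
    rw [← encard_image_Icc (theta n) m, alcoveDist]
    apply Set.encard_le_encard
    rintro ⟨_, k⟩ ⟨⟨i, j, hij, rfl⟩, hs⟩
    obtain ⟨rfl, rfl⟩ := fin_pair_of_two hn hij
    refine ⟨k, ?_, rfl⟩
    rcases hs with ⟨h1, h2⟩ | ⟨h1, h2⟩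
    · have h3 := mem_halfPos_root.mp (h1 hbB)
      have h4 := mem_halfNeg_root.mp (h2 hc)
      simp only at h3 h4
      rw [hb] at h3
      constructor
      · have : (0 : ℝ) < k := by linarith
        have : 0 < k := by exact_mod_cast this
        omega
      · have : (k : ℝ) < m + 1 := by linarith
        have : k < m + 1 := by exact_mod_cast this
        omega
    · have h3 := mem_halfNeg_root.mp (h1 hbB)
      have h4 := mem_halfPos_root.mp (h2 hc)
      simp only at h3 h4
      rw [hb] at h3
      have : (0 : ℝ) ≤ m := Nat.cast_nonneg m
      exfalso
      have h5 : (0 : ℝ) < k := by linarith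
      have h6 : (k : ℝ) < 1 := by linarith
      have h5' : 0 < k := by exact_mod_cast h5
      have h6' : k < 1 := by exact_mod_cast h6
      omega
  have hA' : ((m + 1 : ℕ) : ℕ∞) ≤ alcoveDist A (fundamentalAlcove n) := by
    rw [← encard_image_Icc (theta n) (m + 1), alcoveDist]
    apply Set.encard_le_encard
    rintro _ ⟨k, ⟨hk1, hk2⟩, rfl⟩
    refine ⟨⟨0, -1, h01, rfl⟩, Or.inl ⟨fun y hy => ?_, fun y hy => ?_⟩⟩
    · have h1 := mem_halfPos_root.mp (hL hy)
      have : (k : ℝ) ≤ L := by exact_mod_cast (by omega : k ≤ L)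
      exact mem_halfPos_root.mpr (this.trans h1)
    · have h1 := mem_halfNeg_root.mp (interior_subset hy).1
      have : ((1 : ℤ) : ℝ) ≤ k := by exact_mod_cast hk1
      exact mem_halfNeg_root.mpr (h1.trans this)
  have := (hA'.trans hdist).trans hB
  rw [Nat.cast_le] at this
  omega

end

end ShiCore

open ShiCore in
theorem mainTheorem3 (n m : ℕ) [NeZero n] (hn : 2 ≤ n) (hm : 1 ≤ m)
    (R A : Set (ShiCore.V n)) (μ : YoungDiagram)
    (hR : ShiCore.IsDominantRegion n m R)
    (hA : ShiCore.IsMinimalAlcove n R A)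
    (hμ : ShiCore.IsCore n μ)
    (hΦ : ShiCore.PhiMapsTo n μ A) :
    ShiCore.IsSeparatingWall n m (ShiCore.theta n) (m : ℤ) R ↔
      ShiCore.hookLength μ (0, 0) = n * (m - 1) + 1 := by
  obtain ⟨w, -, ⟨ω, rfl, rfl⟩, hAw⟩ := hΦ
  have hn0 : (0 : ℝ) < n := by exact_mod_cast (by omega : 0 < n)
  have hnz : (0 : ℤ) < n := by omega
  have hm1 : (1 : ℝ) ≤ m := by exact_mod_cast hm
  have h01 := zero_lt_neg_one hn
  have hshift := add_mul_of_add (affPerm_add hn ω)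
  have hext : ∀ (x : V n) (i : Fin n),
      (geomAction n ((affSystem n).wordProd ω)⁻¹ x).1 i = affExt x (affPerm hn ω (i : ℕ)) :=
    fun x i => by rw [← affExt_coe, affExt_geomAction hn]
  set φ := affPerm hn ω with hφ
  have hlast : (((-1 : Fin n) : ℕ) : ℤ) = n - 1 := by
    rw [val_neg_one]
    omega
  set q : V n := geomAction n ((affSystem n).wordProd ω)⁻¹ (alcoveCenter n) with hq
  have hqA : q ∈ A := hAw ▸ Set.mem_image_of_mem _ (alcoveCenter_mem hn)
  have hqR : q ∈ R := hA.2.1 hqA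
  have hqd : ∀ i j : Fin n, q.1 i - q.1 j = ((φ (j : ℕ) : ℝ) - φ (i : ℕ)) / n := fun i j => by
    rw [hq, hext, hext, affExt_alcoveCenter hn]
  have hndvd : ∀ i j : Fin n, i ≠ j → ¬ (n : ℤ) ∣ φ (j : ℕ) - φ (i : ℕ) := by
    rintro i j hij ⟨c, hc⟩
    have h1 : φ (j : ℕ) = φ ((i : ℕ) + n * c) := by rw [hshift]; linarith
    have h2 := φ.injective h1
    exact hij ((dvd_sub_iff j i).mp ⟨c, by linarith⟩).symm
  have hmono : ∀ i j : Fin n, i < j → φ (i : ℕ) < φ (j : ℕ) := by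
    intro i j hij
    have h1 := antitone_of_mem_dominantChamber (hR.2 hqR) hij.le
    rw [← sub_nonneg, hqd, le_div_iff₀ hn0, zero_mul, sub_nonneg] at h1
    have h2 : φ (i : ℕ) ≤ φ (j : ℕ) := by exact_mod_cast h1
    refine lt_of_le_of_ne h2 fun h => hndvd i j hij.ne ?_
    rw [h, sub_self]
    exact dvd_zero _
  rw [hookLength_eq_iff hn hm ω fun i j hij hj => hmono ⟨i, by omega⟩ ⟨j, hj⟩ hij, ← hφ, ← hlast]
  constructor
  · rintro ⟨hW, hS⟩
    have hRm : ∀ x ∈ R, (m : ℝ) ≤ x.1 0 - x.1 (-1) := by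
      rcases hS with ⟨h, -⟩ | ⟨-, h⟩
      · exact fun x hx => by simpa using mem_halfPos_root.mp (h hx)
      · have h1 := mem_halfPos_root.mp (h (alcoveCenter_mem hn))
        rw [alcoveCenter_theta hn, Int.cast_natCast] at h1
        have : 0 < (1 : ℝ) / n := by positivity
        linarith
    have hge : (n : ℤ) * m ≤ φ ((-1 : Fin n) : ℕ) - φ 0 := by
      have h1 := hRm q hqR
      rw [hqd, le_div_iff₀ hn0, Fin.val_zero, Nat.cast_zero] at h1
      have h2 : (m : ℤ) * n ≤ φ ((-1 : Fin n) : ℕ) - φ 0 := by exact_mod_cast h1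
      linarith
    have hfl : ∀ j : Fin n, 0 < j → j < -1 → ∃ k : ℤ, n * k < φ (j : ℕ) - φ 0 ∧
        φ (j : ℕ) - φ 0 < n * (k + 1) ∧ φ ((-1 : Fin n) : ℕ) - φ (j : ℕ) < n * (m - k) := by
      intro j h0 h1
      obtain ⟨k, hk1, hk2, -, hk4⟩ := floors_of_wall hn hR hW h0 h1 hqR
      rw [hqd, Fin.val_zero, Nat.cast_zero] at hk1 hk2
      rw [hqd] at hk4
      rw [lt_div_iff₀ hn0] at hk1
      rw [div_lt_iff₀ hn0] at hk2 hk4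
      refine ⟨k, ?_, ?_, ?_⟩
      · rw [mul_comm]
        exact_mod_cast hk1
      · have : ((φ (j : ℕ) - φ 0 : ℤ) : ℝ) < ((n * (k + 1) : ℤ) : ℝ) := by
          push_cast
          linarith
        exact Int.cast_lt.mp this
      · have : ((φ ((-1 : Fin n) : ℕ) - φ (j : ℕ) : ℤ) : ℝ) < ((n * (m - k) : ℤ) : ℝ) := by
          push_cast
          linarith
        exact Int.cast_lt.mp this
    obtain ⟨z, hz⟩ := φ.surjective (φ 0 + 1)
    obtain ⟨i, l, hi, rfl⟩ := exists_window hn z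
    rw [hshift] at hz
    have hi0 : i ≠ 0 := by
      rintro rfl
      rw [Nat.cast_zero] at hz
      exact not_dvd_one hn ⟨l, by linarith⟩
    have hi0' : (0 : Fin n) < ⟨i, hi⟩ := by
      rw [Fin.lt_def, Fin.val_zero]
      exact Nat.pos_of_ne_zero hi0
    by_cases hil : i < n - 1
    · exfalso
      obtain ⟨k, hk1, hk2, hk3⟩ := hfl ⟨i, hi⟩ hi0' (by rw [Fin.lt_def, val_neg_one]; exact hil)
      simp only at hk1 hk2 hk3
      have hlk : -l = k := by
        have h1 : (n : ℤ) * k < n * (-l + 1) := by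
          rw [mul_add, mul_neg, mul_one]
          omega
        have h2 : (n : ℤ) * (-l) < n * (k + 1) := by
          rw [mul_neg]
          omega
        have h1' := lt_of_mul_lt_mul_left h1 hnz.le
        have h2' := lt_of_mul_lt_mul_left h2 hnz.le
        omega
      subst hlk
      rw [sub_neg_eq_add, mul_add] at hk3
      apply hndvd 0 (-1) h01.ne
      rw [Fin.val_zero, Nat.cast_zero]
      exact ⟨m, by linarith⟩
    · have hil' : ((-1 : Fin n) : ℕ) = i := by
        rw [val_neg_one]
        omega
      rw [← hil'] at hz
      have hLm : -l = m := by
        apply le_antisymm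
        · by_cases h2 : n = 2
          · have hqm : (m : ℝ) < q.1 0 - q.1 (-1) := by
              refine lt_of_le_of_ne (hRm q hqR) fun h => ?_
              apply hndvd 0 (-1) h01.ne
              rw [hqd, eq_div_iff hn0.ne'] at h
              exact ⟨m, by rw [mul_comm]; exact_mod_cast h.symm⟩
            refine level_le_of_minimal h2 hR.1 hA hqR hqm ?_
            rw [hAw]
            rintro _ ⟨x, hx, rfl⟩
            have h3 := affExt_antitone hn hx (by omega : φ 0 ≤ φ 0 + 1)
            have h4 := affExt_add_mul x (φ ((-1 : Fin n) : ℕ)) l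
            rw [hz] at h4
            rw [theta, mem_halfPos_root, hext, hext, Fin.val_zero, Nat.cast_zero]
            push_cast
            linarith
          · obtain ⟨k, hk1, hk2, hk3⟩ := hfl ⟨1, by omega⟩
              (by rw [Fin.lt_def, Fin.val_zero]; exact one_pos)
              (by rw [Fin.lt_def, val_neg_one]; simp only; omega)
            have h3 : (n : ℤ) * (-l) < n * (m + 1) := by linarith
            have := lt_of_mul_lt_mul_left h3 hnz.le
            omega
        · have h3 : (n : ℤ) * m < n * (-l + 1) := by
            rw [mul_add, mul_neg, mul_one]
            omega
          have := lt_of_mul_lt_mul_left h3 hnz.le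
          omega
      rw [← hLm]
      linarith
  · intro hw
    have hw' : φ ((-1 : Fin n) : ℕ) = φ ((0 : Fin n) : ℕ) + n * m + 1 := by
      rw [hw, Fin.val_zero, Nat.cast_zero]
    have hqθ : (m : ℝ) < q.1 0 - q.1 (-1) := by
      rw [hqd, lt_div_iff₀ hn0, hw']
      push_cast
      linarith
    refine ⟨⟨⟨theta n, ⟨0, -1, h01, rfl⟩, m, by omega, le_rfl, rfl⟩, ?_⟩, Or.inl ⟨?_, ?_⟩⟩
    · exact_mod_cast affineSpan_wall hn hR.1 hqR (a := fun i => φ (i : ℕ)) hqd hndvd hw'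
    · intro y hy
      rcases shi_side hR.1 hqR hy h01 (k := m) (by omega) le_rfl with h | h
      · exact mem_halfPos_root.mpr h.2.le
      · have := h.1
        rw [Int.cast_natCast] at this
        linarith
    · intro y hy
      have h1 := mem_halfNeg_root.mp (interior_subset hy).1
      refine mem_halfNeg_root.mpr (h1.trans ?_)
      rw [Int.cast_one, Int.cast_natCast]
      exact hm1
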